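/- Let $d\ge 1$ and $n\ge 2$ be fixed integers, and let $\ell:\mathbb R\to[0,\infty)$ satisfy $\ell(0)=0$, $\ell(-e)=\ell(e)$ for all $e$, and $\ell(e)<\ell(e')\Leftrightarrow|e|<|e'|$ for all $e,e'$. For a data set $S=\{(x_i,y_i)\}_{i=1}^N\subset\mathbb R^d\times\mathbb R$ let $$\mathcal Q_S=\Big\{q\in\{1,\dots,n\}^N:\ \text{there are pairwise distinct } w_1,\dots,w_n\in\mathbb R^d \text{ with } q_i\in\operatorname*{argmin}_{1\le j\le n}\ell(y_i-w_j^Tx_i)\text{ for } i=1,\dots,N\Big\}$$ be its set of minimum-error classifications. Say that $S$ is in general position if no affine hyperplane of $\mathbb R^d$ contains more than $d$ of the points $x_1,\dots,x_N$ and no affine hyperplane of $\mathbb R^{d+1}$ contains more than $d+1$ of the points $z_i=(x_i,y_i)$, $i=1,\dots,N$ (points counted with their indices). Then $$\Pi(N):=\sup\{|\mathcal Q_S|:\ S\text{ a data set of } N \text{ points in general position}\}=O\big(N^{2dn(n-1)}\big)\quad(N\to\infty),$$ and $\mathcal Q_S$ can be computed in $O(N^{2dn(n-1)})$ time: there are a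 program for the real random-access machine (integer and real arrays with computed indices; additions and subtractions of integers, the four operations on reals, comparisons, assignments and outputs at unit cost) and a constant $C$, such that for every $N\ge1$ and every data set $S$ of $N$ points in general position the program, started on $S$, halts after at most $C\,N^{2dn(n-1)}$ steps and has then output a list of all elements of $\mathcal Q_S$, each exactly once. -/

import Mathlib

namespace SwitchReg

/-- Admissible loss functions: nonnegative, zero at `0`, even, and strictly increasing in `|e|`. -/
structure IsLoss (ℓ : ℝ → ℝ) : Prop where
  nonneg : ∀ e, 0 ≤ ℓ e
  zero : ℓ 0 = 0
  even : ∀ e, ℓ (-e) = ℓ e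
  lt_iff : ∀ e e', ℓ e < ℓ e' ↔ |e| < |e'|

/-- The family `p` of `N` points of `ℝ^D` is in general position: no (affine) hyperplane
`{v | a · v = b}`, `a ≠ 0`, contains more than `D` of the points, counted with their indices. -/
def GeneralPosition {D N : ℕ} (p : Fin N → Fin D → ℝ) : Prop :=
  ∀ (a : Fin D → ℝ) (b : ℝ), a ≠ 0 → {i : Fin N | dotProduct a (p i) = b}.ncard ≤ D

/-- The points `z_i = (x_i, y_i)` of `ℝ^(d+1)`. -/
def joint {d N : ℕ} (x : Fin N → Fin d → ℝ) (y : Fin N → ℝ) : Fin N → Fin (d + 1) → ℝ :=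
  fun i => Fin.snoc (α := fun _ => ℝ) (x i) (y i)

/-- The data set `(x_i, y_i)` is in general position: the `x_i` are so in `ℝ^d`, and the
`z_i = (x_i, y_i)` are so in `ℝ^(d+1)`. -/
def DataGeneralPosition {d N : ℕ} (x : Fin N → Fin d → ℝ) (y : Fin N → ℝ) : Prop :=
  GeneralPosition x ∧ GeneralPosition (joint x y)

/-- The set of minimum-error classifications of a data set: the `q` for which there are pairwise
distinct parameter vectors `w_1, …, w_n` with `q_i ∈ argmin_j ℓ (y_i - w_j · x_i)` for all `i`. -/
def minErr (ℓ : ℝ → ℝ) (n : ℕ) {d N : ℕ} (x : Fin N → Fin d → ℝ) (y : Fin N → ℝ) :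
    Set (Fin N → Fin n) :=
  {q | ∃ w : Fin n → Fin d → ℝ, Function.Injective w ∧
    ∀ i j, ℓ (y i - dotProduct (w (q i)) (x i)) ≤ ℓ (y i - dotProduct (w j) (x i))}

/-- The possible numbers of minimum-error classifications of `N` data points in general
position. -/
def minErrCounts (ℓ : ℝ → ℝ) (d n N : ℕ) : Set ℕ :=
  {c | ∃ (x : Fin N → Fin d → ℝ) (y : Fin N → ℝ),
    DataGeneralPosition x y ∧ (minErr ℓ n x y).ncard = c}

/-- The supremum in `maxCount` is over a bounded set, so that it is a true supremum. -/
theorem bddAbove_minErrCounts (ℓ : ℝ → ℝ) (d n N : ℕ) : BddAbove (minErrCounts ℓ d n N) := by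
  refine ⟨Nat.card (Fin N → Fin n), ?_⟩
  rintro c ⟨x, y, _, rfl⟩
  exact Set.ncard_le_card _

/-- `Π(N)`: the largest number of minimum-error classifications of `N` data points in general
position. -/
noncomputable def maxCount (ℓ : ℝ → ℝ) (d n N : ℕ) : ℕ := sSup (minErrCounts ℓ d n N)

/-! ### The real random-access machine

A machine with arrays of natural numbers (used for indices, counters and labels), arrays of real
numbers, and an output tape of natural numbers. A program is a finite text, so it uses finitely
many arrays; array names are part of the text, and cells are addressed by computed natural
numbers. Every arithmetic operation, memory access, comparison, assignment and output costs one
unit of time. There is no rounding or other passage from the reals to the naturals except by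
comparing two reals. -/

/-- Contents of the memory and of the output tape. -/
structure Store where
  nat : ℕ → ℕ → ℕ
  real : ℕ → ℕ → ℝ
  out : List ℕ

/-- Expressions with natural-number values (`sub` is truncated subtraction). -/
inductive NExp : Type where
  | const (c : ℕ) : NExp
  | cell (a : ℕ) (i : NExp) : NExp
  | add (e f : NExp) : NExp
  | sub (e f : NExp) : NExp

/-- Expressions with real values (division by zero gives zero). -/
inductive RExp : Type where
  | const (c : ℤ) : RExp
  | cell (a : ℕ) (i : NExp) : RExp
  | add (e f : RExp) : RExp
  | sub (e f : RExp) : RExp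
  | mul (e f : RExp) : RExp
  | div (e f : RExp) : RExp

/-- Tests. -/
inductive BExp : Type where
  | ltN (e f : NExp) : BExp
  | ltR (e f : RExp) : BExp
  | not (b : BExp) : BExp
  | and (b c : BExp) : BExp

/-- Programs. `setN a i e` writes the value of `e` into cell `i` of the natural-number array `a`,
`setR a i e` does so for the real array `a`, and `emit e` appends the value of `e` to the
output. -/
inductive Prog : Type where
  | skip : Prog
  | setN (a : ℕ) (i e : NExp) : Prog
  | setR (a : ℕ) (i : NExp) (e : RExp) : Prog
  | emit (e : NExp) : Prog
  | seq (p q : Prog) : Prog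
  | branch (b : BExp) (p q : Prog) : Prog
  | loop (b : BExp) (p : Prog) : Prog

/-- Value of a natural-number expression. -/
def NExp.eval (s : Store) : NExp → ℕ
  | .const c => c
  | .cell a i => s.nat a (i.eval s)
  | .add e f => e.eval s + f.eval s
  | .sub e f => e.eval s - f.eval s

/-- Cost of a natural-number expression: the number of its nodes. -/
def NExp.cost : NExp → ℕ
  | .const _ => 1
  | .cell _ i => i.cost + 1
  | .add e f => e.cost + f.cost + 1
  | .sub e f => e.cost + f.cost + 1

/-- Value of a real expression. -/
noncomputable def RExp.eval (s : Store) : RExp → ℝ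
  | .const c => (c : ℝ)
  | .cell a i => s.real a (i.eval s)
  | .add e f => e.eval s + f.eval s
  | .sub e f => e.eval s - f.eval s
  | .mul e f => e.eval s * f.eval s
  | .div e f => e.eval s / f.eval s

/-- Cost of a real expression: the number of its nodes. -/
def RExp.cost : RExp → ℕ
  | .const _ => 1
  | .cell _ i => i.cost + 1
  | .add e f => e.cost + f.cost + 1
  | .sub e f => e.cost + f.cost + 1
  | .mul e f => e.cost + f.cost + 1
  | .div e f => e.cost + f.cost + 1

/-- Truth of a test. -/
def BExp.Holds (s : Store) : BExp → Prop
  | .ltN e f => e.eval s < f.eval s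
  | .ltR e f => e.eval s < f.eval s
  | .not b => ¬ b.Holds s
  | .and b c => b.Holds s ∧ c.Holds s

/-- Cost of a test: the number of its nodes. -/
def BExp.cost : BExp → ℕ
  | .ltN e f => e.cost + f.cost + 1
  | .ltR e f => e.cost + f.cost + 1
  | .not b => b.cost + 1
  | .and b c => b.cost + c.cost + 1

/-- Overwrite cell `i` of the natural-number array `a`. -/
def Store.writeN (s : Store) (a i v : ℕ) : Store :=
  { s with nat := Function.update s.nat a (Function.update (s.nat a) i v) }

/-- Overwrite cell `i` of the real array `a`. -/
noncomputable def Store.writeR (s : Store) (a i : ℕ) (v : ℝ) : Store :=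
  { s with real := Function.update s.real a (Function.update (s.real a) i v) }

/-- `Exec p s t s'`: started in `s`, the program `p` halts after exactly `t` units of time, in the
store `s'`. -/
inductive Exec : Prog → Store → ℕ → Store → Prop where
  | skip (s : Store) : Exec .skip s 1 s
  | setN (a : ℕ) (i e : NExp) (s : Store) :
      Exec (.setN a i e) s (i.cost + e.cost + 1) (s.writeN a (i.eval s) (e.eval s))
  | setR (a : ℕ) (i : NExp) (e : RExp) (s : Store) :
      Exec (.setR a i e) s (i.cost + e.cost + 1) (s.writeR a (i.eval s) (e.eval s))
  | emit (e : NExp) (s : Store) :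
      Exec (.emit e) s (e.cost + 1) { s with out := s.out ++ [e.eval s] }
  | seq {p q : Prog} {s s' s'' : Store} {t t' : ℕ} :
      Exec p s t s' → Exec q s' t' s'' → Exec (.seq p q) s (t + t') s''
  | branch_true {b : BExp} {p q : Prog} {s s' : Store} {t : ℕ} :
      b.Holds s → Exec p s t s' → Exec (.branch b p q) s (b.cost + t) s'
  | branch_false {b : BExp} {p q : Prog} {s s' : Store} {t : ℕ} :
      ¬ b.Holds s → Exec q s t s' → Exec (.branch b p q) s (b.cost + t) s'
  | loop_true {b : BExp} {p : Prog} {s s' s'' : Store} {t t' : ℕ} :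
      b.Holds s → Exec p s t s' → Exec (.loop b p) s' t' s'' →
      Exec (.loop b p) s (b.cost + t + t') s''
  | loop_false {b : BExp} {p : Prog} {s : Store} :
      ¬ b.Holds s → Exec (.loop b p) s b.cost s

/-- The initial store on a data set: cell `0` of the natural-number array `0` holds `N`; cell `i`
of the real array `k` holds the `k`-th coordinate of `x_i` if `k < d`, and `y_i` if `k = d`
(`i < N`, counted from `0`); all other cells hold `0`, and the output is empty. -/
noncomputable def inputStore {d N : ℕ} (x : Fin N → Fin d → ℝ) (y : Fin N → ℝ) : Store where
  nat := fun a i => if a = 0 ∧ i = 0 then N else 0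
  real := fun a i => if h : i < N ∧ a < d + 1 then joint x y ⟨i, h.1⟩ ⟨a, h.2⟩ else 0
  out := []

/-- The word `o` lists the set `Q` of classifications: it is the concatenation, in some order and
without repetition, of the words `q_1 … q_N` for `q ∈ Q` (labels counted from `0`). -/
def Lists {N n : ℕ} (o : List ℕ) (Q : Set (Fin N → Fin n)) : Prop :=
  ∃ L : List (Fin N → Fin n), L.Nodup ∧ (∀ q, q ∈ L ↔ q ∈ Q) ∧
    o = (L.map fun q => List.ofFn fun i => (q i : ℕ)).flatten

end SwitchReg

/-!
Consider the parameters `w_1, …, w_n ∈ ℝ^d` as a point of `ℝ^(nd)`, homogenized by a variable `t`.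
Since `(y - a)² ≤ (y - b)²` if and only if `(b - a) (2 y - a - b) ≤ 0`, the sets of labels of
minimal error at the data points depend only on the signs of the linear forms `(w_j - w_k) · x_i`
and `2 y_i t - (w_j + w_k) · x_i`, that is, on the face of a central arrangement of `O(N)`
hyperplanes of `ℝ^(nd+1)` (`argSign_pointSign`). With the coordinate functions and the coordinates
of the `w_j - w_k` added, the arrangement is essential, and the face also tells whether the `w_j`
are distinct and whether `t > 0`.

A face of an essential arrangement is described by a flag: `nd + 1` independent forms of the
arrangement with dual basis `e_r`, and signs `s_r`, such that the face contains
`s_0 e_0 + ε s_1 e_1 + ε² s_2 e_2 + ⋯` for small `ε > 0` (`exists_flag`). Conversely all these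
lexicographic sign patterns are realized (`exists_sign_eq_sign_lead`). By Cramer's rule the value of
a form on `e_r` is a quotient of determinants of constant size, so that the sign of any form on the
face is found by a test of constant cost. There are `O(N^(nd+1))` flags.

On a face with distinct `w_j`, general position leaves at most a constant number of data points at
which the label of minimal error is not unique (`ncard_ties_le`), hence a constant number of ways
to break the ties, and the program text can run through them. For each flag and each way to break
ties the program finds a classification in `O(N)` steps, inserts it into a prefix tree, and writes it
to the output if it was not yet there. The total time is `O(N^(nd+2))`, and
`nd + 2 ≤ 2nd ≤ 2dn(n - 1)`. The bound on the number of classifications follows, because each of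
them takes at least one step to write down (`maxCount_le`).
-/

namespace SwitchReg

/-! ### Faces of a hyperplane arrangement -/

/-- The first nonzero entry of a list of reals, or `0`: its sign is the sign of
`a₀ + a₁ ε + a₂ ε² + ⋯` for all small `ε > 0`. -/
noncomputable def lead : List ℝ → ℝ
  | [] => 0
  | a :: l => if a = 0 then lead l else a

theorem lead_map_mul {c : ℝ} (hc : 0 < c) (l : List ℝ) :
    SignType.sign (lead (l.map (c * ·))) = SignType.sign (lead l) := by
  induction l with
  | nil => rfl
  | cons a l ih =>
    by_cases ha : a = 0
    · simpa [lead, ha] using ih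
    · simp [lead, ha, hc.ne', sign_mul, sign_pos hc]

theorem lead_eq_zero_of_forall {l : List ℝ} (h : ∀ a ∈ l, a = 0) : lead l = 0 := by
  induction l with
  | nil => rfl
  | cons a l ih => simp_all [lead]

theorem sign_add_eq_left {a b : ℝ} (h : |b| < |a|) :
    SignType.sign (a + b) = SignType.sign a := by
  rcases lt_trichotomy a 0 with ha | rfl | ha
  · rw [abs_of_neg ha] at h
    rw [sign_neg ha, sign_neg]
    linarith [le_abs_self b]
  · simp at h
    exact absurd h (not_lt.2 (abs_nonneg b))
  · rw [abs_of_pos ha] at h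
    rw [sign_pos ha, sign_pos]
    linarith [neg_abs_le b]

section Arrangement

variable {V ι : Type*} [AddCommGroup V] [Module ℝ V] [Finite ι]

/-- Every lexicographic sign pattern is realized by a point: `u₀ + ε u₁ + ε² u₂ + ⋯` with a small
`ε > 0`. -/
theorem exists_sign_eq_sign_lead (g : ι → V →ₗ[ℝ] ℝ) (us : List V) :
    ∃ w, ∀ m, SignType.sign (g m w) = SignType.sign (lead (us.map (g m))) := by
  induction us with
  | nil => exact ⟨0, fun m => by simp [lead]⟩
  | cons u us ih =>
    obtain ⟨w, hw⟩ := ih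
    have key : ∀ m, ∀ᶠ ε in nhdsWithin (0 : ℝ) (Set.Ioi 0),
        g m u ≠ 0 → |ε * g m w| < |g m u| := by
      intro m
      by_cases h : g m u = 0
      · simp [h]
      · have hc : Filter.Tendsto (fun ε : ℝ => |ε * g m w|) (nhdsWithin 0 (Set.Ioi 0))
            (nhds 0) := by
          have : Filter.Tendsto (fun ε : ℝ => |ε * g m w|) (nhds 0) (nhds |0 * g m w|) :=
            Continuous.tendsto (by fun_prop) 0
          rw [zero_mul, abs_zero] at this
          exact this.mono_left nhdsWithin_le_nhds
        filter_upwards [hc.eventually (gt_mem_nhds (abs_pos.2 h))] with ε hε _ using hε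
    obtain ⟨ε, hε, hpos⟩ := ((Filter.eventually_all.2 key).and self_mem_nhdsWithin).exists
    refine ⟨u + ε • w, fun m => ?_⟩
    by_cases h : g m u = 0
    · simp [lead, h, sign_mul, sign_pos (show (0 : ℝ) < ε from hpos), hw]
    · simpa [lead, h] using sign_add_eq_left (hε m h)

/-- If `g o w ≠ 0`, then the vector `v` spans an extreme ray of the closure of the face containing
`w` of a central arrangement. It is found as a minimizer of the number of forms that do not vanish,
among the points of the closure at which the form `g o` has the same value as at `w`. -/
theorem exists_extreme_ray (g : ι → V →ₗ[ℝ] ℝ) (hsep : ∀ v, (∀ m, g m v = 0) → v = 0)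
    (w : V) (o : ι) :
    ∃ v, g o v = g o w ∧ (∀ m, g m v ≠ 0 → SignType.sign (g m v) = SignType.sign (g m w)) ∧
      ∀ u, (∀ m, g m v = 0 → g m u = 0) → g o u = 0 → u = 0 := by
  classical
  have := Fintype.ofFinite ι
  let S : Set V := {v | g o v = g o w ∧
    ∀ m, g m v ≠ 0 → SignType.sign (g m v) = SignType.sign (g m w)}
  let c : V → ℕ := fun v => (Finset.univ.filter fun m => g m v ≠ 0).card
  have hS : S.Nonempty := ⟨w, rfl, fun _ _ => rfl⟩
  obtain ⟨v, hvS, hmin⟩ : ∃ v ∈ S, ∀ v' ∈ S, c v ≤ c v' :=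
    ⟨Function.argminOn c S hS, Function.argminOn_mem c S hS,
      fun v' hv' => Function.argminOn_le c S hv'⟩
  refine ⟨v, hvS.1, hvS.2, fun u hu huo => ?_⟩
  by_contra hu0
  have hne : (Finset.univ.filter fun m => g m u ≠ 0).Nonempty := by
    by_contra h
    rw [Finset.not_nonempty_iff_eq_empty, Finset.filter_eq_empty_iff] at h
    exact hu0 (hsep u fun m => by simpa using h (Finset.mem_univ m))
  -- Move from `v` along `u` until the first form with a nonzero value on `u` vanishes.
  obtain ⟨k, hk, hkmin⟩ := Finset.exists_min_image _ (fun m => |g m v| / |g m u|) hne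
  have hku : g k u ≠ 0 := by simpa using hk
  set r : ℝ := g k v / g k u with hr
  have hval : ∀ m, g m (v - r • u) = g m v + -(r * g m u) := by intro m; simp [sub_eq_add_neg]
  have hle : ∀ m, |-(r * g m u)| ≤ |g m v| := by
    intro m
    by_cases hm : g m u = 0
    · simp [hm]
    · have h1 := hkmin m (by simpa using hm)
      rw [le_div_iff₀ (abs_pos.2 hm)] at h1
      rwa [abs_neg, abs_mul, hr, abs_div]
  have hv' : v - r • u ∈ S := by
    refine ⟨by rw [hval, huo, mul_zero, neg_zero, add_zero]; exact hvS.1, fun m hm => ?_⟩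
    have hmv : g m v ≠ 0 := by
      intro h0
      apply hm
      rw [hval, h0, hu m h0]
      simp
    rw [← hvS.2 m hmv, hval]
    rcases (hle m).lt_or_eq with h | h
    · exact sign_add_eq_left h
    · rw [hval] at hm
      rcases abs_eq_abs.1 h with h | h
      · rw [h, ← two_mul, sign_mul, sign_pos two_pos, one_mul]
      · rw [h, add_neg_cancel] at hm
        exact absurd rfl hm
  have hlt : c (v - r • u) < c v := by
    refine Finset.card_lt_card (Finset.ssubset_iff_of_subset ?_ |>.2 ⟨k, ?_, ?_⟩)
    · intro m hm
      simp only [Finset.mem_filter, Finset.mem_univ, true_and] at hm ⊢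
      intro h0
      apply hm
      rw [hval, h0, hu m h0]
      simp
    · simp only [Finset.mem_filter, Finset.mem_univ, true_and]
      exact fun h0 => hku (hu k h0)
    · simp only [Finset.mem_filter, Finset.mem_univ, true_and, not_not]
      rw [hval, hr, div_mul_cancel₀ _ hku, add_neg_cancel]
  exact absurd (hmin _ hv') (not_le.2 hlt)

end Arrangement

universe u v

/-- Every face of an essential central arrangement is described by a flag: there are forms
`g (m 0), …, g (m (D - 1))` with dual basis `e`, and signs `s`, such that the face contains
`s₀ e₀ + ε s₁ e₁ + ε² s₂ e₂ + ⋯` for all small `ε > 0`. For `w ≠ 0`, the vector `s₀ e₀` spans an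
extreme ray of the closure of the face, and the others come from the arrangement which the forms vanishing on that ray induce on
the kernel of `g (m 0)`. -/
theorem exists_flag (D : ℕ) : ∀ (V : Type u) [AddCommGroup V] [Module ℝ V]
    [FiniteDimensional ℝ V] (ι : Type v) [Finite ι] (g : ι → V →ₗ[ℝ] ℝ),
    Module.finrank ℝ V = D → (∀ v, (∀ m, g m v = 0) → v = 0) → ∀ w : V,
    ∃ (m : Fin D → ι) (e : Fin D → V) (s : Fin D → SignType),
      (∀ a b, g (m a) (e b) = if a = b then 1 else 0) ∧
      ∀ k, SignType.sign (lead (List.ofFn fun r => (s r : ℝ) * g k (e r))) =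
        SignType.sign (g k w) := by
  induction D with
  | zero =>
    intro V _ _ _ ι _ g hD _ w
    have := Module.finrank_zero_iff.1 hD
    refine ⟨Fin.elim0, Fin.elim0, Fin.elim0, fun a => a.elim0, fun k => ?_⟩
    rw [Subsingleton.elim w 0]
    simp [lead]
  | succ D ih =>
    intro V _ _ _ ι _ g hD hsep w
    have main : ∀ w : V, w ≠ 0 → ∃ (m : Fin (D + 1) → ι) (e : Fin (D + 1) → V)
        (s : Fin (D + 1) → SignType), (∀ a b, g (m a) (e b) = if a = b then 1 else 0) ∧
        ∀ k, SignType.sign (lead (List.ofFn fun r => (s r : ℝ) * g k (e r))) =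
          SignType.sign (g k w) := by
      intro w hw
      obtain ⟨o, ho⟩ : ∃ o, g o w ≠ 0 := by
        by_contra! h
        exact hw (hsep w h)
      obtain ⟨v, hov, hconf, huniq⟩ := exists_extreme_ray g hsep w o
      have hov0 : g o v ≠ 0 := by rwa [hov]
      have hsub : ∀ m : {m // g m v = 0}, g m (w - v) = g m w := by
        intro m
        rw [map_sub, m.2, sub_zero]
      have hmem : w - v ∈ LinearMap.ker (g o) := by
        rw [LinearMap.mem_ker, map_sub, hov, sub_self]
      have hrank : Module.finrank ℝ (LinearMap.ker (g o)) = D := by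
        have h1 := LinearMap.finrank_range_add_finrank_ker (g o)
        have h2 : LinearMap.range (g o) = ⊤ :=
          LinearMap.range_eq_top.2 (LinearMap.surjective (fun h => ho (by rw [h]; rfl)))
        rw [h2, finrank_top, Module.finrank_self] at h1
        omega
      obtain ⟨m, e, s, hdual, hsign⟩ := ih (LinearMap.ker (g o)) {m // g m v = 0}
        (fun m => (g m).comp (LinearMap.ker (g o)).subtype) hrank
        (fun u hu => Subtype.ext (huniq u (fun k hk => hu ⟨k, hk⟩) u.2)) ⟨w - v, hmem⟩
      refine ⟨Fin.cons o fun a => (m a : ι), Fin.cons ((g o v)⁻¹ • v) fun b => (e b : V),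
        Fin.cons (SignType.sign (g o v)) s, ?_, ?_⟩
      · intro a b
        refine Fin.cases ?_ (fun a => ?_) a <;> refine Fin.cases ?_ (fun b => ?_) b
        · simp [hov0]
        · simp [(Fin.succ_ne_zero b).symm]
        · simp [(m a).2]
        · simpa using hdual a b
      · intro k
        rw [List.ofFn_succ]
        simp only [Fin.cons_zero, Fin.cons_succ, map_smul, smul_eq_mul, lead]
        by_cases hk : g k v = 0
        · simp only [hk, mul_zero, if_true]
          rw [← hsub ⟨k, hk⟩]
          exact hsign ⟨k, hk⟩
        · have hpos : (0 : ℝ) < (SignType.sign (g o v) : ℝ) * (g o v)⁻¹ := by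
            rcases lt_or_gt_of_ne hov0 with h | h
            · simp [sign_neg h, h]
            · simp [sign_pos h, h]
          rw [← mul_assoc, if_neg (mul_ne_zero hpos.ne' hk), sign_mul, sign_pos hpos, one_mul,
            hconf k hk]
    by_cases hw : w = 0
    · have : Nontrivial V := Module.nontrivial_of_finrank_pos (R := ℝ) (by omega)
      obtain ⟨w', hw'⟩ := exists_ne (0 : V)
      obtain ⟨m, e, s, hdual, -⟩ := main w' hw'
      refine ⟨m, e, fun _ => 0, hdual, fun k => ?_⟩
      rw [hw, map_zero, lead_eq_zero_of_forall]
      simp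
    · exact main w hw

section Cramer

open Matrix

variable {D : ℕ} {ι : Type*}

/-- The vectors of a flag in coordinates, up to the common factor `det A`, where the rows of `A`
are the chosen forms: by Cramer's rule the entries of this list are the values of the form `f` on
the columns of the adjugate of `A`, times the signs `s`. -/
noncomputable def flagValues (A : Matrix (Fin D) (Fin D) ℝ) (s : Fin D → SignType)
    (f : Fin D → ℝ) : List ℝ :=
  List.ofFn fun r => (s r : ℝ) * (A.updateRow r f).det

theorem det_updateRow_eq_dotProduct (A : Matrix (Fin D) (Fin D) ℝ) (f : Fin D → ℝ) (r : Fin D) :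
    (A.updateRow r f).det = f ⬝ᵥ (fun c => A.adjugate c r) := by
  rw [← cramer_transpose_apply, cramer_eq_adjugate_mulVec, ← adjugate_transpose, mulVec,
    dotProduct_comm]
  rfl

/-- Sign patterns given by flags are realized. -/
theorem exists_sign_eq_flagValues [Finite ι] (F : ι → Fin D → ℝ)
    (A : Matrix (Fin D) (Fin D) ℝ) (s : Fin D → SignType) :
    ∃ w : Fin D → ℝ, ∀ k, SignType.sign (lead (flagValues A s (F k))) =
      SignType.sign (F k ⬝ᵥ w) := by
  obtain ⟨w, hw⟩ := exists_sign_eq_sign_lead (fun k => dotProductBilin ℝ ℝ (F k))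
    (List.ofFn fun r => (s r : ℝ) • fun c => A.adjugate c r)
  refine ⟨w, fun k => ?_⟩
  rw [show F k ⬝ᵥ w = dotProductBilin ℝ ℝ (F k) w from rfl, hw]
  congr 2
  rw [flagValues, List.map_ofFn]
  congr 1
  funext r
  simp only [Function.comp, map_smul, smul_eq_mul]
  rw [det_updateRow_eq_dotProduct]
  rfl

/-- Every realized sign pattern is given by a flag. -/
theorem exists_flagValues_sign_eq [Finite ι] (F : ι → Fin D → ℝ)
    (hF : ∀ v : Fin D → ℝ, (∀ k, F k ⬝ᵥ v = 0) → v = 0) (w : Fin D → ℝ) :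
    ∃ (m : Fin D → ι) (s : Fin D → SignType), ∀ k,
      SignType.sign (lead (flagValues (of fun r => F (m r)) s (F k))) =
        SignType.sign (F k ⬝ᵥ w) := by
  obtain ⟨m, e, s, hdual, hsign⟩ := exists_flag D (Fin D → ℝ) ι
    (fun k => dotProductBilin ℝ ℝ (F k)) (by simp) hF w
  set A : Matrix (Fin D) (Fin D) ℝ := of fun r => F (m r) with hA
  set E : Matrix (Fin D) (Fin D) ℝ := of fun c r => e r c with hE
  have hAE : A * E = 1 := by
    ext a b
    rw [one_apply, ← hdual a b]
    rfl
  have hdet : A.det ≠ 0 := fun h => by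
    have := congrArg det hAE
    rw [det_mul, h, zero_mul, det_one] at this
    exact zero_ne_one this
  have hadj : A.adjugate = A.det • E := by
    rw [← mul_one A.adjugate, ← hAE, ← mul_assoc, adjugate_mul, smul_mul, one_mul]
  refine ⟨m, fun r => s r * SignType.sign A.det, fun k => ?_⟩
  have hpt : (fun r => ((s r * SignType.sign A.det : SignType) : ℝ) *
      (A.updateRow r (F k)).det) = fun r => |A.det| * (s r * (F k ⬝ᵥ e r)) := by
    funext r
    have h1 : (fun c => (A.det • E) c r) = A.det • e r := rfl
    have h2 : ((s r * SignType.sign A.det : SignType) : ℝ) = s r * (SignType.sign A.det : ℝ) :=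
      map_mul SignType.castHom _ _
    rw [det_updateRow_eq_dotProduct, hadj, h1, dotProduct_smul, smul_eq_mul, h2,
      ← sign_mul_self A.det]
    ring
  have hmap := lead_map_mul (abs_pos.2 hdet) (List.ofFn fun r => (s r : ℝ) * (F k ⬝ᵥ e r))
  rw [List.map_ofFn] at hmap
  rw [flagValues, hpt]
  exact hmap.trans (hsign k)

end Cramer

/-! ### Reasoning about programs -/

/-- Started in the store `s`, the program `p` halts within `T` units of time in a store that
satisfies `Q`. -/
def Runs (p : Prog) (s : Store) (T : ℕ) (Q : Store → Prop) : Prop :=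
  ∃ t s', Exec p s t s' ∧ t ≤ T ∧ Q s'

theorem Runs.mono {p : Prog} {s : Store} {T T' : ℕ} {Q Q' : Store → Prop} (h : Runs p s T Q)
    (hT : T ≤ T') (hQ : ∀ s', Q s' → Q' s') : Runs p s T' Q' := by
  obtain ⟨t, s', he, ht, hq⟩ := h
  exact ⟨t, s', he, ht.trans hT, hQ _ hq⟩

theorem Runs.seq {p q : Prog} {s : Store} {T T' : ℕ} {Q : Store → Prop}
    (h : Runs p s T fun s' => Runs q s' T' Q) : Runs (.seq p q) s (T + T') Q := by
  obtain ⟨t, s', he, ht, t', s'', he', ht', hq⟩ := h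
  exact ⟨t + t', s'', he.seq he', add_le_add ht ht', hq⟩

theorem Runs.branch_true {b : BExp} {p q : Prog} {s : Store} {T : ℕ} {Q : Store → Prop}
    (hb : b.Holds s) (h : Runs p s T Q) : Runs (.branch b p q) s (b.cost + T) Q := by
  obtain ⟨t, s', he, ht, hq⟩ := h
  exact ⟨_, s', .branch_true hb he, by omega, hq⟩

theorem Runs.branch_false {b : BExp} {p q : Prog} {s : Store} {T : ℕ} {Q : Store → Prop}
    (hb : ¬ b.Holds s) (h : Runs q s T Q) : Runs (.branch b p q) s (b.cost + T) Q := by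
  obtain ⟨t, s', he, ht, hq⟩ := h
  exact ⟨_, s', .branch_false hb he, by omega, hq⟩

/-- The program `p` contains an assignment to the natural-number array `a`. -/
def Prog.WritesN (a : ℕ) : Prog → Prop
  | .setN b _ _ => b = a
  | .seq p q => p.WritesN a ∨ q.WritesN a
  | .branch _ p q => p.WritesN a ∨ q.WritesN a
  | .loop _ p => p.WritesN a
  | _ => False

/-- The program `p` contains an assignment to a real array. -/
def Prog.WritesR : Prog → Prop
  | .setR _ _ _ => True
  | .seq p q => p.WritesR ∨ q.WritesR
  | .branch _ p q => p.WritesR ∨ q.WritesR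
  | .loop _ p => p.WritesR
  | _ => False

/-- The program `p` contains an output statement. -/
def Prog.Emits : Prog → Prop
  | .emit _ => True
  | .seq p q => p.Emits ∨ q.Emits
  | .branch _ p q => p.Emits ∨ q.Emits
  | .loop _ p => p.Emits
  | _ => False

theorem Exec.nat_eq {p : Prog} {s s' : Store} {t a : ℕ} (h : Exec p s t s')
    (ha : ¬ p.WritesN a) : s'.nat a = s.nat a := by
  induction h with
  | setN b i e s => exact Function.update_of_ne (Ne.symm ha) _ _
  | seq _ _ ih1 ih2 => exact (ih2 fun h => ha (.inr h)).trans (ih1 fun h => ha (.inl h))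
  | branch_true _ _ ih => exact ih fun h => ha (.inl h)
  | branch_false _ _ ih => exact ih fun h => ha (.inr h)
  | loop_true _ _ _ ih1 ih2 => exact (ih2 ha).trans (ih1 ha)
  | _ => rfl

theorem Exec.real_eq {p : Prog} {s s' : Store} {t : ℕ} (h : Exec p s t s')
    (ha : ¬ p.WritesR) : s'.real = s.real := by
  induction h with
  | setR b i e s => exact absurd trivial ha
  | seq _ _ ih1 ih2 => exact (ih2 fun h => ha (.inr h)).trans (ih1 fun h => ha (.inl h))
  | branch_true _ _ ih => exact ih fun h => ha (.inl h)
  | branch_false _ _ ih => exact ih fun h => ha (.inr h)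
  | loop_true _ _ _ ih1 ih2 => exact (ih2 ha).trans (ih1 ha)
  | _ => rfl

theorem Exec.out_eq {p : Prog} {s s' : Store} {t : ℕ} (h : Exec p s t s')
    (ha : ¬ p.Emits) : s'.out = s.out := by
  induction h with
  | emit e s => exact absurd trivial ha
  | seq _ _ ih1 ih2 => exact (ih2 fun h => ha (.inr h)).trans (ih1 fun h => ha (.inl h))
  | branch_true _ _ ih => exact ih fun h => ha (.inl h)
  | branch_false _ _ ih => exact ih fun h => ha (.inr h)
  | loop_true _ _ _ ih1 ih2 => exact (ih2 ha).trans (ih1 ha)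
  | _ => rfl

/-- A program writes at most one symbol per unit of time. -/
theorem Exec.length_out_le {p : Prog} {s s' : Store} {t : ℕ} (h : Exec p s t s') :
    s'.out.length ≤ s.out.length + t := by
  induction h with
  | emit e s => simp
  | seq _ _ ih1 ih2 => omega
  | branch_true _ _ ih => omega
  | branch_false _ _ ih => omega
  | loop_true _ _ _ ih1 ih2 => omega
  | setN b i e s => exact Nat.le_add_right _ _
  | setR b i e s => exact Nat.le_add_right _ _
  | _ => exact Nat.le_add_right _ _

theorem Runs.frame {p : Prog} {s : Store} {T : ℕ} {Q : Store → Prop} (h : Runs p s T Q) :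
    Runs p s T fun s' => Q s' ∧ (∀ a, ¬ p.WritesN a → s'.nat a = s.nat a) ∧
      (¬ p.WritesR → s'.real = s.real) ∧ (¬ p.Emits → s'.out = s.out) := by
  obtain ⟨t, s', he, ht, hq⟩ := h
  exact ⟨t, s', he, ht, hq, fun _ => he.nat_eq, he.real_eq, he.out_eq⟩

/-- The program contains no loop. -/
def Prog.LoopFree : Prog → Prop
  | .seq p q => p.LoopFree ∧ q.LoopFree
  | .branch _ p q => p.LoopFree ∧ q.LoopFree
  | .loop _ _ => False
  | _ => True

/-- The final store of a loop-free program (loops are ignored). -/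
noncomputable def Prog.run : Prog → Store → Store
  | .skip, s => s
  | .setN a i e, s => s.writeN a (i.eval s) (e.eval s)
  | .setR a i e, s => s.writeR a (i.eval s) (e.eval s)
  | .emit e, s => { s with out := s.out ++ [e.eval s] }
  | .seq p q, s => q.run (p.run s)
  | .branch b p q, s => open Classical in if b.Holds s then p.run s else q.run s
  | .loop _ _, s => s

/-- A bound for the running time of a loop-free program (loops are ignored). -/
def Prog.bound : Prog → ℕ
  | .skip => 1
  | .setN _ i e => i.cost + e.cost + 1
  | .setR _ i e => i.cost + e.cost + 1
  | .emit e => e.cost + 1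
  | .seq p q => p.bound + q.bound
  | .branch b p q => b.cost + (p.bound + q.bound)
  | .loop _ _ => 0

theorem Prog.LoopFree.runs {p : Prog} (hp : p.LoopFree) (s : Store) :
    Runs p s p.bound fun s' => s' = p.run s := by
  induction p generalizing s with
  | skip => exact ⟨_, _, .skip s, le_rfl, rfl⟩
  | setN a i e => exact ⟨_, _, .setN a i e s, le_rfl, rfl⟩
  | setR a i e => exact ⟨_, _, .setR a i e s, le_rfl, rfl⟩
  | emit e => exact ⟨_, _, .emit e s, le_rfl, rfl⟩
  | seq p q ih1 ih2 =>
    refine Runs.seq ((ih1 hp.1 s).mono le_rfl ?_)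
    rintro _ rfl
    exact ih2 hp.2 _
  | branch b p q ih1 ih2 =>
    by_cases hb : b.Holds s
    · refine (Runs.branch_true hb (ih1 hp.1 s)).mono (by simp only [bound]; omega) ?_
      rintro _ rfl
      simp [run, hb]
    · refine (Runs.branch_false hb (ih2 hp.2 s)).mono (by simp only [bound]; omega) ?_
      rintro _ rfl
      simp [run, hb]
  | loop b p => exact hp.elim

theorem Prog.LoopFree.runs_of {p : Prog} (hp : p.LoopFree) {s : Store} {Q : Store → Prop}
    (h : Q (p.run s)) : Runs p s p.bound Q :=
  (hp.runs s).mono le_rfl fun _ hs => hs ▸ h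

@[simp] theorem Store.writeN_real (s : Store) (a i v : ℕ) : (s.writeN a i v).real = s.real := rfl

@[simp] theorem Store.writeN_out (s : Store) (a i v : ℕ) : (s.writeN a i v).out = s.out := rfl

theorem Store.writeN_nat (s : Store) (a i v b j : ℕ) :
    (s.writeN a i v).nat b j = if b = a ∧ j = i then v else s.nat b j := by
  by_cases hb : b = a
  · subst hb
    by_cases hj : j = i <;> simp [writeN, hj]
  · simp [writeN, hb]

theorem Store.writeN_nat_of_ne (s : Store) {a b : ℕ} (i v : ℕ) (h : b ≠ a) :
    (s.writeN a i v).nat b = s.nat b :=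
  Function.update_of_ne h _ _

/-- Cell `0` of the natural-number array `a`, used as a register. -/
def reg (a : ℕ) : NExp := .cell a (.const 0)

@[simp] theorem reg_eval (a : ℕ) (s : Store) : (reg a).eval s = s.nat a 0 := rfl

/-- Run `p` with the register `a` equal to `0, …, N - 1`, where `N` is in the register `0`. -/
def forLoop (a : ℕ) (p : Prog) : Prog :=
  .seq (.setN a (.const 0) (.const 0))
    (.loop (.ltN (reg a) (reg 0)) (.seq p (.setN a (.const 0) (.add (reg a) (.const 1)))))

/-- The rule for bounded loops, with the loop invariant `I` and a bound `T` for the body. -/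
theorem runs_forLoop {a N T : ℕ} {p : Prog} (hN : 1 ≤ N) (ha : a ≠ 0) (h0 : ¬ p.WritesN 0)
    (hap : ¬ p.WritesN a) (I : ℕ → Store → Prop) (hI : ∀ i s v, I i s → I i (s.writeN a 0 v))
    (step : ∀ i < N, ∀ s, s.nat 0 0 = N → s.nat a 0 = i → I i s → Runs p s T (I (i + 1)))
    {s : Store} (hs : s.nat 0 0 = N) (init : I 0 s) :
    Runs (forLoop a p) s (N * (T + 19)) (I N) := by
  have hloop : ∀ k i s, i + k = N → s.nat 0 0 = N → s.nat a 0 = i → I i s →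
      Runs (.loop (.ltN (reg a) (reg 0)) (.seq p (.setN a (.const 0) (.add (reg a) (.const 1)))))
        s (k * (T + 11) + 5) (I N) := by
    intro k
    induction k with
    | zero =>
      intro i s hi h0 ha hI
      refine ⟨_, _, .loop_false ?_, ?_, ?_⟩
      · simp only [BExp.Holds, reg_eval]
        omega
      · simp [BExp.cost, NExp.cost, reg]
      · rwa [show N = i by omega]
    | succ k ih =>
      intro i s hi hs0 hsa hIs
      obtain ⟨t, s', he, ht, hIs'⟩ := step i (by omega) s hs0 hsa hIs
      have hs'a : s'.nat a 0 = i := by rw [he.nat_eq hap, hsa]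
      have hs'0 : s'.nat 0 0 = N := by rw [he.nat_eq h0, hs0]
      obtain ⟨t', s'', he', ht', hIs''⟩ := ih (i + 1) (s'.writeN a 0 (i + 1)) (by omega)
        (by rw [Store.writeN_nat_of_ne _ _ _ ha.symm, hs'0]) (by simp [Store.writeN_nat])
        (hI _ _ _ hIs')
      have hset : Exec (.setN a (.const 0) (.add (reg a) (.const 1))) s' 6
          (s'.writeN a 0 (i + 1)) := by
        have h := Exec.setN a (.const 0) (.add (reg a) (.const 1)) s'
        simpa [NExp.eval, NExp.cost, hs'a, reg] using h
      refine ⟨_, s'', .loop_true ?_ (.seq he hset) he', ?_, hIs''⟩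
      · simp only [BExp.Holds, reg_eval]
        omega
      · simp only [BExp.cost, NExp.cost, reg]
        nlinarith
  refine Runs.mono (T := 3 + (N * (T + 11) + 5)) (Runs.seq ⟨_, _, .setN _ _ _ _, le_rfl,
    hloop N 0 _ (by omega) ?_ ?_ (hI _ _ _ init)⟩) (by nlinarith) fun _ h => h
  · rw [Store.writeN_nat_of_ne _ _ _ ha.symm, hs]
  · simp [Store.writeN_nat, NExp.eval]

@[simp] theorem forLoop_writesN {a b : ℕ} {p : Prog} :
    (forLoop a p).WritesN b ↔ a = b ∨ p.WritesN b := by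
  simp only [forLoop, Prog.WritesN]
  tauto

@[simp] theorem forLoop_writesR {a : ℕ} {p : Prog} : (forLoop a p).WritesR ↔ p.WritesR := by
  simp [forLoop, Prog.WritesR]

@[simp] theorem forLoop_emits {a : ℕ} {p : Prog} : (forLoop a p).Emits ↔ p.Emits := by
  simp [forLoop, Prog.Emits]

/-- Run the programs of a list one after the other. -/
def seqAll : List Prog → Prog
  | [] => .skip
  | p :: l => .seq p (seqAll l)

/-- Run the first program of the list whose guard holds, if there is one. -/
def firstOf : List (BExp × Prog) → Prog
  | [] => .skip
  | bp :: l => .branch bp.1 bp.2 (firstOf l)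

theorem firstOf_loopFree {l : List (BExp × Prog)} (h : ∀ bp ∈ l, bp.2.LoopFree) :
    (firstOf l).LoopFree := by
  induction l with
  | nil => trivial
  | cons bp l ih => exact ⟨h _ (by simp), ih fun bp h' => h _ (by simp [h'])⟩

theorem firstOf_writesN {a : ℕ} {l : List (BExp × Prog)} (h : ∀ bp ∈ l, ¬ bp.2.WritesN a) :
    ¬ (firstOf l).WritesN a := by
  induction l with
  | nil => exact id
  | cons bp l ih =>
    rintro (h' | h')
    · exact h _ (by simp) h'
    · exact ih (fun bp h' => h _ (by simp [h'])) h'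

theorem firstOf_writesR {l : List (BExp × Prog)} (h : ∀ bp ∈ l, ¬ bp.2.WritesR) :
    ¬ (firstOf l).WritesR := by
  induction l with
  | nil => exact id
  | cons bp l ih =>
    rintro (h' | h')
    · exact h _ (by simp) h'
    · exact ih (fun bp h' => h _ (by simp [h'])) h'

theorem firstOf_emits {l : List (BExp × Prog)} (h : ∀ bp ∈ l, ¬ bp.2.Emits) :
    ¬ (firstOf l).Emits := by
  induction l with
  | nil => exact id
  | cons bp l ih =>
    rintro (h' | h')
    · exact h _ (by simp) h'
    · exact ih (fun bp h' => h _ (by simp [h'])) h'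

/-- If some guard in `l` holds, then a program of `l` with a true guard is run. -/
theorem firstOf_append_run {l l' : List (BExp × Prog)} {s : Store}
    (h : ∃ bp ∈ l, bp.1.Holds s) :
    ∃ bp ∈ l, bp.1.Holds s ∧ (firstOf (l ++ l')).run s = bp.2.run s := by
  induction l with
  | nil => simp at h
  | cons bp l ih =>
    by_cases hb : bp.1.Holds s
    · exact ⟨bp, by simp, hb, by simp [firstOf, Prog.run, hb]⟩
    · obtain ⟨bp', h1, h2, h3⟩ := ih (by simpa [hb] using h)
      exact ⟨bp', by simp [h1], h2, by simp [firstOf, Prog.run, hb, h3]⟩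

theorem firstOf_append_run_right {l l' : List (BExp × Prog)} {s : Store}
    (h : ∀ bp ∈ l, ¬ bp.1.Holds s) : (firstOf (l ++ l')).run s = (firstOf l').run s := by
  induction l with
  | nil => rfl
  | cons bp l ih =>
    have hb : ¬ bp.1.Holds s := h _ (by simp)
    have := ih fun bp' h' => h _ (by simp [h'])
    simp [firstOf, Prog.run, hb, this]

/-- Nested loops: run `p` with the registers `8, …, 7 + k` running independently through
`0, …, N - 1`. -/
def nest (p : Prog) : ℕ → Prog
  | 0 => p
  | k + 1 => forLoop (8 + k) (nest p k)

theorem nest_writesN {p : Prog} {a k : ℕ} (hp : ¬ p.WritesN a) (ha : a < 8 ∨ 8 + k ≤ a) :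
    ¬ (nest p k).WritesN a := by
  induction k with
  | zero => exact hp
  | succ k ih =>
    simp only [nest, forLoop_writesN, not_or]
    exact ⟨by omega, ih (by omega)⟩

section Collect

variable {β : Type*} (G : Set β → Store → Prop)

/-- Composition of programs that enlarge a set `X` kept in the store, as described by `G`: if `f a`
puts the elements of `C a` into `X`, then running all these programs does so for all `a`. -/
theorem runs_seqAll_collect {α : Type*} {f : α → Prog} {C : α → Set β} {T : ℕ} {l : List α}
    (hf : ∀ a ∈ l, ∀ X s, G X s → Runs (f a) s T fun s' => ∃ X', X ⊆ X' ∧ C a ⊆ X' ∧ G X' s')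
    (X : Set β) (s : Store) (hX : G X s) :
    Runs (seqAll (l.map f)) s (l.length * T + 1) fun s' =>
      ∃ X', X ⊆ X' ∧ (∀ a ∈ l, C a ⊆ X') ∧ G X' s' := by
  induction l generalizing X s with
  | nil => exact ⟨1, s, .skip s, by simp, X, subset_rfl, by simp, hX⟩
  | cons a l ih =>
    refine Runs.mono (T := T + (l.length * T + 1))
      (Runs.seq ((hf a (by simp) X s hX).mono le_rfl ?_))
      (by simp only [List.length_cons]; nlinarith) fun _ h => h
    rintro s' ⟨X', hXX', hC, hG⟩
    refine (ih (fun a h => hf a (by simp [h])) X' s' hG).mono le_rfl ?_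
    rintro s'' ⟨X'', hX'', hC', hG'⟩
    refine ⟨X'', hXX'.trans hX'', ?_, hG'⟩
    intro b hb
    rcases List.mem_cons.1 hb with rfl | hb
    · exact hC.trans hX''
    · exact hC' b hb

/-- The rule for nested loops whose body enlarges a set `X` kept in the store by `C ι`, where `ι`
are the values of the loop registers. -/
theorem runs_nest_collect {p : Prog} {N D T : ℕ} {C : (Fin D → Fin N) → Set β} (hN : 1 ≤ N)
    (hGN : ∀ X s, G X s → s.nat 0 0 = N)
    (hG : ∀ X s a v, 8 ≤ a → G X s → G X (s.writeN a 0 v))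
    (hp : ∀ a, a = 0 ∨ 8 ≤ a → ¬ p.WritesN a)
    (hbody : ∀ X s (ι : Fin D → Fin N), G X s → (∀ j : Fin D, s.nat (8 + j) 0 = ι j) →
      Runs p s T fun s' => ∃ X', X ⊆ X' ∧ C ι ⊆ X' ∧ G X' s')
    (k : ℕ) (hk : k ≤ D) (X : Set β) (s : Store) (hX : G X s)
    (hs : ∀ j : Fin D, k ≤ j → s.nat (8 + j) 0 < N) :
    Runs (nest p k) s (N ^ k * (T + 19 * k)) fun s' =>
      ∃ X', X ⊆ X' ∧ (∀ ι : Fin D → Fin N,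
        (∀ j : Fin D, k ≤ j → s.nat (8 + j) 0 = ι j) → C ι ⊆ X') ∧ G X' s' := by
  induction k generalizing X s with
  | zero =>
    refine (hbody X s (fun j => ⟨s.nat (8 + j) 0, hs j (Nat.zero_le _)⟩) hX
      fun j => rfl).mono (by simp) ?_
    rintro s' ⟨X', hXX', hC, hG'⟩
    refine ⟨X', hXX', fun ι hι => ?_, hG'⟩
    rwa [show ι = fun j => ⟨s.nat (8 + j) 0, hs j (Nat.zero_le _)⟩ from
      funext fun j => Fin.ext (hι j (Nat.zero_le _)).symm]
  | succ k ih =>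
    have hframe : ∀ a, a = 0 ∨ 8 + k ≤ a → ¬ (nest p k).WritesN a := fun a ha =>
      nest_writesN (hp a (by omega)) (by omega)
    refine Runs.mono (runs_forLoop (T := N ^ k * (T + 19 * k)) hN (by omega) (hframe 0 (by simp))
      (hframe (8 + k) (by simp))
      (fun i s' => (∀ j : Fin D, k + 1 ≤ j → s'.nat (8 + j) 0 = s.nat (8 + j) 0) ∧
        ∃ X', X ⊆ X' ∧ (∀ ι : Fin D → Fin N,
          (∀ j : Fin D, k + 1 ≤ j → s.nat (8 + j) 0 = ι j) → (ι ⟨k, hk⟩ : ℕ) < i → C ι ⊆ X') ∧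
          G X' s') ?_ ?_ (hGN X s hX) ?_) ?_ ?_
    · rintro i s' v ⟨h1, X', h2, h3, h4⟩
      refine ⟨fun j hj => ?_, X', h2, h3, hG _ _ _ _ (by omega) h4⟩
      rw [Store.writeN_nat_of_ne _ _ _ (by omega), h1 j hj]
    · rintro i hi s' hs'0 hs'k ⟨h1, X', h2, h3, h4⟩
      refine (ih (by omega) X' s' h4 ?_).frame.mono le_rfl ?_
      · intro j hj
        rcases hj.eq_or_lt with hj | hj
        · rw [← hj, hs'k]
          exact hi
        · rw [h1 j hj]
          exact hs j hj
      · rintro s'' ⟨⟨X'', h5, h6, h7⟩, hfr, -, -⟩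
        refine ⟨fun j hj => ?_, X'', h2.trans h5, fun ι hι hιk => ?_, h7⟩
        · rw [hfr _ (hframe _ (by omega)), h1 j hj]
        · rcases (Nat.lt_succ_iff.1 hιk).eq_or_lt with hik | hik
          · refine h6 ι fun j hj => ?_
            rcases hj.eq_or_lt with hj | hj
            · have hjk : j = ⟨k, hk⟩ := Fin.ext hj.symm
              subst hjk
              rw [hik]
              exact hs'k
            · rw [h1 j hj, hι j hj]
          · exact (h3 ι hι hik).trans h5
    · exact ⟨fun j _ => rfl, X, subset_rfl, fun ι _ h => absurd h (Nat.not_lt_zero _), hX⟩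
    · have := Nat.one_le_pow k N hN
      rw [pow_succ]
      nlinarith [Nat.mul_le_mul_left N this]
    · rintro s' ⟨-, X', h2, h3, h4⟩
      exact ⟨X', h2, fun ι hι => h3 ι hι (ι ⟨k, hk⟩).2, h4⟩

end Collect

/-! ### The forms whose signs determine the classifications -/

section Forms

/-- Linear forms in the parameters `w_1, …, w_n ∈ ℝ^d` and a homogenizing variable `t`, for the data
point `(x_i, y_i)`: `diff j k` is `(w_j - w_k) · x_i`, `mid j k` is `2 y_i t - (w_j + w_k) · x_i`,
`sep j k c` is the coordinate `c` of `w_j - w_k`, and `coord` gives the variables themselves. -/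
inductive Form (n d : ℕ) : Type where
  | diff (j k : Fin n) : Form n d
  | mid (j k : Fin n) : Form n d
  | sep (j k : Fin n) (c : Fin d) : Form n d
  | coord (a : Option (Fin n × Fin d)) : Form n d
  deriving DecidableEq, Fintype

variable {n d : ℕ}

/-- The coefficient of a form at a variable (`none` is `t`), for the data point `i` of the data in
the real arrays `R`. -/
noncomputable def Form.coeff (R : ℕ → ℕ → ℝ) (i : ℕ) :
    Form n d → Option (Fin n × Fin d) → ℝ
  | .diff j k, some (l, c) => ((if l = j then 1 else 0) - (if l = k then 1 else 0)) * R c i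
  | .diff _ _, none => 0
  | .mid j k, some (l, c) => (-(if l = j then 1 else 0) - (if l = k then 1 else 0)) * R c i
  | .mid _ _, none => 2 * R d i
  | .sep j k c, some (l, c') => if c' = c then (if l = j then 1 else 0) - (if l = k then 1 else 0)
      else 0
  | .sep _ _ _, none => 0
  | .coord a, b => if a = b then 1 else 0

/-- An expression for `Form.coeff`, with the index of the data point given by `e`. -/
def Form.coeffExp (e : NExp) : Form n d → Option (Fin n × Fin d) → RExp
  | .diff j k, some (l, c) =>
      .mul (.const ((if l = j then 1 else 0) - (if l = k then 1 else 0))) (.cell c e)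
  | .diff _ _, none => .const 0
  | .mid j k, some (l, c) =>
      .mul (.const (-(if l = j then 1 else 0) - (if l = k then 1 else 0))) (.cell c e)
  | .mid _ _, none => .mul (.const 2) (.cell d e)
  | .sep j k c, some (l, c') =>
      .const (if c' = c then (if l = j then 1 else 0) - (if l = k then 1 else 0) else 0)
  | .sep _ _ _, none => .const 0
  | .coord a, b => .const (if a = b then 1 else 0)

theorem Form.coeffExp_eval (s : Store) (e : NExp) (τ : Form n d) (a : Option (Fin n × Fin d)) :
    (τ.coeffExp e a).eval s = τ.coeff s.real (e.eval s) a := by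
  cases τ <;> rcases a with _ | ⟨l, c⟩ <;> simp [coeffExp, coeff, RExp.eval]

/-- The number of variables of the forms. -/
abbrev dim (n d : ℕ) : ℕ := n * d + 1

/-- A numbering of the variables. -/
noncomputable def varEquiv (n d : ℕ) : Fin (dim n d) ≃ Option (Fin n × Fin d) :=
  (Fintype.equivFinOfCardEq (by simp)).symm

/-- The coefficient vector of a form. -/
noncomputable def Form.vec (R : ℕ → ℕ → ℝ) (i : ℕ) (τ : Form n d) : Fin (dim n d) → ℝ :=
  fun b => τ.coeff R i (varEquiv n d b)

/-- The value of the variable `t` at a point. -/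
noncomputable def homVar (W : Fin (dim n d) → ℝ) : ℝ := W ((varEquiv n d).symm none)

/-- The value of the parameter vector `w_j` at a point. -/
noncomputable def parVec (W : Fin (dim n d) → ℝ) (j : Fin n) : Fin d → ℝ :=
  fun c => W ((varEquiv n d).symm (some (j, c)))

theorem Form.vec_dotProduct (R : ℕ → ℕ → ℝ) (i : ℕ) (τ : Form n d) (W : Fin (dim n d) → ℝ) :
    τ.vec R i ⬝ᵥ W = τ.coeff R i none * homVar W +
      ∑ l, ∑ c, τ.coeff R i (some (l, c)) * parVec W l c := by
  rw [dotProduct, ← (varEquiv n d).symm.sum_comp, Fintype.sum_option, Fintype.sum_prod_type]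
  simp [vec, homVar, parVec]

theorem diff_value (R : ℕ → ℕ → ℝ) (i : ℕ) (j k : Fin n) (W : Fin (dim n d) → ℝ) :
    (Form.diff j k).vec R i ⬝ᵥ W =
      parVec W j ⬝ᵥ (fun c => R c i) - parVec W k ⬝ᵥ (fun c => R c i) := by
  rw [Form.vec_dotProduct]
  simp only [Form.coeff, sub_mul, Finset.sum_sub_distrib, ite_mul, one_mul, zero_mul, dotProduct,
    Finset.sum_ite_irrel, Finset.sum_const_zero, Finset.sum_ite_eq', Finset.mem_univ, if_true,
    zero_add]
  simp only [mul_comm]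

theorem mid_value (R : ℕ → ℕ → ℝ) (i : ℕ) (j k : Fin n) (W : Fin (dim n d) → ℝ) :
    (Form.mid j k).vec R i ⬝ᵥ W = 2 * R d i * homVar W -
      parVec W j ⬝ᵥ (fun c => R c i) - parVec W k ⬝ᵥ (fun c => R c i) := by
  rw [Form.vec_dotProduct]
  simp only [Form.coeff, sub_mul, neg_mul, Finset.sum_sub_distrib, Finset.sum_neg_distrib, ite_mul,
    one_mul, zero_mul, dotProduct, Finset.sum_ite_irrel, Finset.sum_const_zero, Finset.sum_ite_eq',
    Finset.mem_univ, if_true]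
  simp only [mul_comm]
  ring

theorem sep_value (R : ℕ → ℕ → ℝ) (i : ℕ) (j k : Fin n) (c : Fin d) (W : Fin (dim n d) → ℝ) :
    (Form.sep j k c).vec R i ⬝ᵥ W = parVec W j c - parVec W k c := by
  rw [Form.vec_dotProduct]
  simp [Form.coeff, sub_mul, Finset.sum_sub_distrib]

theorem coord_value (R : ℕ → ℕ → ℝ) (i : ℕ) (a : Option (Fin n × Fin d))
    (W : Fin (dim n d) → ℝ) :
    (Form.coord a).vec R i ⬝ᵥ W = W ((varEquiv n d).symm a) := by
  have h : (Form.coord a).vec R i = Pi.single ((varEquiv n d).symm a) 1 := by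
    funext b
    simp only [Form.vec, Form.coeff, Pi.single_apply]
    congr 1
    rw [Equiv.eq_symm_apply]
    exact propext eq_comm
  rw [h, single_one_dotProduct]

/-- The signs of the forms at a point. -/
noncomputable def pointSign (R : ℕ → ℕ → ℝ) (W : Fin (dim n d) → ℝ) (τ : Form n d) (i : ℕ) :
    SignType :=
  SignType.sign (τ.vec R i ⬝ᵥ W)

/-- The matrix whose rows are the forms `τ r` for the data points `ι r`. -/
noncomputable def flagMatrix (R : ℕ → ℕ → ℝ) (τs : Fin (dim n d) → Form n d)
    (ι : Fin (dim n d) → ℕ) : Matrix (Fin (dim n d)) (Fin (dim n d)) ℝ :=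
  Matrix.of fun r => (τs r).vec R (ι r)

/-- The signs of the forms on the face given by a flag. -/
noncomputable def flagSign (R : ℕ → ℕ → ℝ) (τs : Fin (dim n d) → Form n d)
    (σ : Fin (dim n d) → SignType) (ι : Fin (dim n d) → ℕ) (τ : Form n d) (i : ℕ) : SignType :=
  SignType.sign (lead (flagValues (flagMatrix R τs ι) σ (τ.vec R i)))

/-- Every flag describes the face of some point. -/
theorem exists_pointSign_eq_flagSign (R : ℕ → ℕ → ℝ) (N : ℕ) (τs : Fin (dim n d) → Form n d)
    (σ : Fin (dim n d) → SignType) (ι : Fin (dim n d) → ℕ) :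
    ∃ W, ∀ τ, ∀ i < N, flagSign R τs σ ι τ i = pointSign R W τ i := by
  obtain ⟨W, hW⟩ := exists_sign_eq_flagValues
    (fun k : Form n d × Fin N => k.1.vec R k.2) (flagMatrix R τs ι) σ
  exact ⟨W, fun τ i hi => hW (τ, ⟨i, hi⟩)⟩

/-- The face of every point is described by some flag. -/
theorem exists_flagSign_eq_pointSign (R : ℕ → ℕ → ℝ) {N : ℕ} (hN : 1 ≤ N)
    (W : Fin (dim n d) → ℝ) :
    ∃ (τs : Fin (dim n d) → Form n d) (σ : Fin (dim n d) → SignType) (ι : Fin (dim n d) → Fin N),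
      ∀ τ, ∀ i < N, flagSign R τs σ (fun r => ι r) τ i = pointSign R W τ i := by
  obtain ⟨m, σ, h⟩ := exists_flagValues_sign_eq
    (fun k : Form n d × Fin N => k.1.vec R k.2) (fun v hv => by
      funext b
      have := hv (.coord (varEquiv n d b), ⟨0, hN⟩)
      rwa [coord_value, Equiv.symm_apply_apply] at this) W
  exact ⟨fun r => (m r).1, σ, fun r => (m r).2, fun τ i hi => h (τ, ⟨i, hi⟩)⟩

section Signs

variable (sg : Form n d → ℕ → SignType)

/-- In terms of the signs of the forms: at the data point `i` the error of `w_j` is at most that of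
`w_k`. This is because `(y - a)² ≤ (y - b)²` if and only if `(b - a) (2 y - a - b) ≤ 0`. -/
def LeSign (j k : Fin n) (i : ℕ) : Prop :=
  ¬ (sg (.diff k j) i = 1 ∧ sg (.mid j k) i = 1) ∧
    ¬ (sg (.diff k j) i = -1 ∧ sg (.mid j k) i = -1)

/-- In terms of the signs of the forms: `w_j` has minimal error at the data point `i`. -/
def ArgSign (j : Fin n) (i : ℕ) : Prop := ∀ k, LeSign sg j k i

/-- In terms of the signs of the forms: several `w_j` have minimal error at the data point `i`. -/
def TiedSign (i : ℕ) : Prop := ∃ j k, j ≠ k ∧ ArgSign sg j i ∧ ArgSign sg k i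

/-- In terms of the signs of the forms: `t` is positive and the `w_j` are distinct. -/
def ValidSign : Prop :=
  sg (.coord none) 0 = 1 ∧ ∀ j k : Fin n, j ≠ k → ∃ c, sg (.sep j k c) 0 ≠ 0

end Signs

section PointSign

variable {R : ℕ → ℕ → ℝ} {W : Fin (dim n d) → ℝ}

theorem validSign_pointSign :
    ValidSign (pointSign R W) ↔ 0 < homVar W ∧ Function.Injective (parVec W) := by
  simp only [ValidSign, pointSign, coord_value, sep_value, sign_eq_one_iff, Ne, sign_eq_zero_iff,
    sub_eq_zero]
  refine and_congr Iff.rfl ⟨fun h j k hjk => ?_, fun h j k hjk => ?_⟩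
  · by_contra hne
    obtain ⟨c, hc⟩ := h j k hne
    exact hc (congrFun hjk c)
  · by_contra! hc
    exact hjk (h (funext hc))

theorem leSign_pointSign (ht : 0 < homVar W) (j k : Fin n) (i : ℕ) :
    LeSign (pointSign R W) j k i ↔
      |R d i - ((homVar W)⁻¹ • parVec W j) ⬝ᵥ (fun c => R c i)| ≤
        |R d i - ((homVar W)⁻¹ • parVec W k) ⬝ᵥ (fun c => R c i)| := by
  simp only [LeSign, pointSign, diff_value, mid_value, sign_eq_one_iff, sign_eq_neg_one_iff,
    smul_dotProduct, smul_eq_mul]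
  generalize parVec W j ⬝ᵥ (fun c : Fin d => R c i) = a
  generalize parVec W k ⬝ᵥ (fun c : Fin d => R c i) = b
  generalize homVar W = t at *
  rw [← sq_le_sq]
  have key : (R d i - t⁻¹ * b) ^ 2 - (R d i - t⁻¹ * a) ^ 2 =
      -((t⁻¹) ^ 2 * ((b - a) * (2 * R d i * t - a - b))) := by
    field_simp
    ring
  have ht2 : 0 < (t⁻¹) ^ 2 := by positivity
  rw [← sub_nonneg, key, neg_nonneg, ← not_lt, mul_pos_iff_of_pos_left ht2, mul_pos_iff, not_or]

theorem argSign_pointSign {ℓ : ℝ → ℝ} (hℓ : IsLoss ℓ) (ht : 0 < homVar W) (j : Fin n) (i : ℕ) :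
    ArgSign (pointSign R W) j i ↔ ∀ k,
      ℓ (R d i - ((homVar W)⁻¹ • parVec W j) ⬝ᵥ (fun c => R c i)) ≤
        ℓ (R d i - ((homVar W)⁻¹ • parVec W k) ⬝ᵥ (fun c => R c i)) := by
  refine forall_congr' fun k => ?_
  rw [leSign_pointSign ht, ← not_lt, ← not_lt, hℓ.lt_iff]

theorem exists_argSign_pointSign (hn : 1 ≤ n) (ht : 0 < homVar W) (i : ℕ) :
    ∃ j, ArgSign (pointSign R W) j i := by
  have : Nonempty (Fin n) := ⟨⟨0, hn⟩⟩
  obtain ⟨j, hj⟩ := Finite.exists_min fun j : Fin n =>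
    |R d i - ((homVar W)⁻¹ • parVec W j) ⬝ᵥ (fun c => R c i)|
  exact ⟨j, fun k => (leSign_pointSign ht j k i).2 (hj k)⟩

end PointSign

/-! ### Tests of constant cost -/

/-- Sum of a list of expressions. -/
def sumExp : List RExp → RExp
  | [] => .const 0
  | e :: l => .add e (sumExp l)

/-- Product of a list of expressions. -/
def prodExp : List RExp → RExp
  | [] => .const 1
  | e :: l => .mul e (prodExp l)

theorem sumExp_eval (s : Store) (l : List RExp) :
    (sumExp l).eval s = (l.map (RExp.eval s)).sum := by
  induction l with
  | nil => simp [sumExp, RExp.eval]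
  | cons e l ih => simp [sumExp, RExp.eval, ih]

theorem prodExp_eval (s : Store) (l : List RExp) :
    (prodExp l).eval s = (l.map (RExp.eval s)).prod := by
  induction l with
  | nil => simp [prodExp, RExp.eval]
  | cons e l ih => simp [prodExp, RExp.eval, ih]

/-- The determinant of a matrix of expressions, by the Leibniz formula. -/
noncomputable def detExp {D : ℕ} (M : Fin D → Fin D → RExp) : RExp :=
  sumExp ((Finset.univ : Finset (Equiv.Perm (Fin D))).toList.map fun π =>
    .mul (.const (Equiv.Perm.sign π : ℤˣ)) (prodExp (Finset.univ.toList.map fun a => M (π a) a)))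

theorem detExp_eval {D : ℕ} (M : Fin D → Fin D → RExp) (s : Store) :
    (detExp M).eval s = (Matrix.of fun a b => (M a b).eval s).det := by
  rw [detExp, sumExp_eval, Matrix.det_apply', ← Finset.sum_map_toList]
  simp [Function.comp_def, RExp.eval, prodExp_eval]

/-- Disjunction of tests. -/
def BExp.or (b c : BExp) : BExp := .not (.and (.not b) (.not c))

@[simp] theorem BExp.holds_or {s : Store} {b c : BExp} :
    (b.or c).Holds s ↔ b.Holds s ∨ c.Holds s := by
  simp only [BExp.or, Holds]
  tauto

/-- Conjunction of a list of tests. -/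
def andAll : List BExp → BExp
  | [] => .not (.ltN (.const 0) (.const 0))
  | b :: l => .and b (andAll l)

/-- Disjunction of a list of tests. -/
def orAll : List BExp → BExp
  | [] => .ltN (.const 0) (.const 0)
  | b :: l => .or b (orAll l)

@[simp] theorem andAll_holds {s : Store} {l : List BExp} :
    (andAll l).Holds s ↔ ∀ b ∈ l, b.Holds s := by
  induction l with
  | nil => simp [andAll, BExp.Holds]
  | cons b l ih => simp [andAll, BExp.Holds, ih]

@[simp] theorem orAll_holds {s : Store} {l : List BExp} :
    (orAll l).Holds s ↔ ∃ b ∈ l, b.Holds s := by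
  induction l with
  | nil => simp [orAll, BExp.Holds]
  | cons b l ih => simp [orAll, ih]

/-- Test whether the first nonzero entry of a list is positive. -/
def posExp : List RExp → BExp
  | [] => .ltN (.const 0) (.const 0)
  | e :: l => .or (.ltR (.const 0) e) (.and (.not (.ltR e (.const 0))) (posExp l))

/-- Test whether the first nonzero entry of a list is negative. -/
def negExp : List RExp → BExp
  | [] => .ltN (.const 0) (.const 0)
  | e :: l => .or (.ltR e (.const 0)) (.and (.not (.ltR (.const 0) e)) (negExp l))

theorem posExp_holds {s : Store} {l : List RExp} :
    (posExp l).Holds s ↔ 0 < lead (l.map (RExp.eval s)) := by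
  induction l with
  | nil => simp [posExp, BExp.Holds, lead]
  | cons e l ih =>
    simp only [posExp, BExp.holds_or, BExp.Holds, ih, RExp.eval, List.map_cons, lead,
      Int.cast_zero]
    rcases lt_trichotomy (e.eval s) 0 with h | h | h
    · simp [h, h.ne]
    · simp [h]
    · simp [h, h.ne']

theorem negExp_holds {s : Store} {l : List RExp} :
    (negExp l).Holds s ↔ lead (l.map (RExp.eval s)) < 0 := by
  induction l with
  | nil => simp [negExp, BExp.Holds, lead]
  | cons e l ih =>
    simp only [negExp, BExp.holds_or, BExp.Holds, ih, RExp.eval, List.map_cons, lead,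
      Int.cast_zero]
    rcases lt_trichotomy (e.eval s) 0 with h | h | h
    · simp [h, h.ne]
    · simp [h]
    · simp [h, h.ne']

section Tests

variable (τs : Fin (dim n d) → Form n d) (σ : Fin (dim n d) → SignType)

/-- Expressions for the values of a form, for the data point with index `e`, on the vectors of the
flag given by the forms `τs r` for the data points in the registers `8 + r` and the signs `σ`. -/
noncomputable def flagExp (τ : Form n d) (e : NExp) : List RExp :=
  List.ofFn fun r => .mul (.const (σ r : ℤ)) (detExp fun a b =>
    if a = r then τ.coeffExp e (varEquiv n d b)
    else (τs a).coeffExp (reg (8 + a)) (varEquiv n d b))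

/-- The signs of the forms on the face given by `τs`, `σ` and the contents of the store. -/
noncomputable def storeSign (s : Store) : Form n d → ℕ → SignType :=
  flagSign s.real τs σ fun r => s.nat (8 + r) 0

theorem flagExp_eval (s : Store) (τ : Form n d) (e : NExp) :
    SignType.sign (lead ((flagExp τs σ τ e).map (RExp.eval s))) =
      storeSign τs σ s τ (e.eval s) := by
  rw [storeSign, flagSign, flagValues, flagExp, List.map_ofFn]
  congr 3
  funext r
  simp only [Function.comp, RExp.eval, detExp_eval]
  congr 1
  · cases σ r <;> simp
  · congr 1
    ext a b
    by_cases h : a = r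
    · subst h
      simp [Form.coeffExp_eval, Form.vec]
    · simp [h, Form.coeffExp_eval, Form.vec, flagMatrix]

/-- Test for a positive sign. -/
noncomputable def posTest (τ : Form n d) (e : NExp) : BExp := posExp (flagExp τs σ τ e)

/-- Test for a negative sign. -/
noncomputable def negTest (τ : Form n d) (e : NExp) : BExp := negExp (flagExp τs σ τ e)

/-- Test for `ArgSign`. -/
noncomputable def argTest (j : Fin n) (e : NExp) : BExp :=
  andAll (Finset.univ.toList.map fun k : Fin n =>
    .and (.not (.and (posTest τs σ (.diff k j) e) (posTest τs σ (.mid j k) e)))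
      (.not (.and (negTest τs σ (.diff k j) e) (negTest τs σ (.mid j k) e))))

/-- Test for `TiedSign`. -/
noncomputable def tiedTest (e : NExp) : BExp :=
  orAll ((Finset.univ.filter fun jk : Fin n × Fin n => jk.1 ≠ jk.2).toList.map fun jk =>
    .and (argTest τs σ jk.1 e) (argTest τs σ jk.2 e))

/-- Test for `ValidSign`. -/
noncomputable def validTest : BExp :=
  .and (posTest τs σ (.coord none) (.const 0))
    (andAll ((Finset.univ.filter fun jk : Fin n × Fin n => jk.1 ≠ jk.2).toList.map fun jk =>
      orAll (Finset.univ.toList.map fun c : Fin d =>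
        .or (posTest τs σ (.sep jk.1 jk.2 c) (.const 0))
          (negTest τs σ (.sep jk.1 jk.2 c) (.const 0)))))

variable {τs σ} {s : Store}

theorem posTest_holds {τ : Form n d} {e : NExp} :
    (posTest τs σ τ e).Holds s ↔ storeSign τs σ s τ (e.eval s) = 1 := by
  rw [posTest, posExp_holds, ← flagExp_eval, sign_eq_one_iff]

theorem negTest_holds {τ : Form n d} {e : NExp} :
    (negTest τs σ τ e).Holds s ↔ storeSign τs σ s τ (e.eval s) = -1 := by
  rw [negTest, negExp_holds, ← flagExp_eval, sign_eq_neg_one_iff]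

theorem argTest_holds {j : Fin n} {e : NExp} :
    (argTest τs σ j e).Holds s ↔ ArgSign (storeSign τs σ s) j (e.eval s) := by
  simp [argTest, ArgSign, LeSign, BExp.Holds, posTest_holds, negTest_holds]

theorem tiedTest_holds {e : NExp} :
    (tiedTest τs σ e).Holds s ↔ TiedSign (storeSign τs σ s) (e.eval s) := by
  simp [tiedTest, TiedSign, BExp.Holds, argTest_holds]

theorem validTest_holds :
    (validTest τs σ).Holds s ↔ ValidSign (storeSign τs σ s) := by
  have h : ∀ a : SignType, a = 1 ∨ a = -1 ↔ a ≠ 0 := by decide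
  simp only [validTest, ValidSign, BExp.Holds, andAll_holds, List.forall_mem_map]
  simp [posTest_holds, negTest_holds, NExp.eval, h]

end Tests

/-! ### Choosing a label for every data point -/

/-- Test for equality of two natural numbers. -/
def eqTest (e f : NExp) : BExp := .and (.not (.ltN e f)) (.not (.ltN f e))

@[simp] theorem eqTest_holds {s : Store} {e f : NExp} :
    (eqTest e f).Holds s ↔ e.eval s = f.eval s := by
  simp only [eqTest, BExp.Holds]
  omega

/-- A bound for the number of data points in general position at which several of `n` distinct
parameter vectors have minimal error. -/
abbrev maxTies (n d : ℕ) : ℕ := n * n * (2 * d + 1)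

/-- A label `v` that may be given to the data point `i`, if `c` is the number of data points with
ties before `i` and `κ` tells how ties are broken. -/
def IsChoice (sg : Form n d → ℕ → SignType) (κ : Fin (maxTies n d) → Fin n) (c i v : ℕ) : Prop :=
  ∃ j : Fin n, v = j ∧ ArgSign sg j i ∧
    ∀ r : Fin (maxTies n d), (r : ℕ) = c → ArgSign sg (κ r) i → j = κ r

/-! The programs below use the natural-number arrays as follows.
* `0`: the number `N` of data points (as given in the input);
* `1`: the classification under construction;
* `2`: the prefix tree of the classifications found, and `3`: its last node;
* `4`: the current node of the prefix tree;
* `5`: the number of ties met;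
* `6`: whether the current node is new;
* `7`: the current data point;
* `8 + r`: the data point of the `r`-th form of the flag.

The real arrays keep the data. -/

section Fill

variable (τs : Fin (dim n d) → Form n d) (σ : Fin (dim n d) → SignType)
  (κ : Fin (maxTies n d) → Fin n)

/-- The data point is in the register `7`: at the `r`-th tie, the label `κ r`. -/
noncomputable def tieOptions : List (BExp × Prog) :=
  (List.finRange (maxTies n d)).map fun r : Fin (maxTies n d) =>
    (.and (eqTest (reg 5) (.const r)) (argTest τs σ (κ r) (reg 7)),
      .setN 1 (reg 7) (.const (κ r)))

/-- The data point is in the register `7`: any label of minimal error. -/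
noncomputable def argOptions : List (BExp × Prog) :=
  (List.finRange n).map fun j => (argTest τs σ j (reg 7), .setN 1 (reg 7) (.const j))

/-- Give a label to the data point in the register `7`, and count ties in the register `5`. -/
noncomputable def pickStep : Prog :=
  .seq
    (firstOf (tieOptions τs σ κ ++ argOptions τs σ))
    (.branch (tiedTest τs σ (reg 7)) (.setN 5 (.const 0) (.add (reg 5) (.const 1))) .skip)

/-- Write labels of minimal error for all data points into the array `1`. -/
noncomputable def fillProg : Prog :=
  .seq (.setN 5 (.const 0) (.const 0)) (forLoop 7 (pickStep τs σ κ))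

theorem pickStep_loopFree : (pickStep τs σ κ).LoopFree := by
  refine ⟨firstOf_loopFree ?_, trivial, trivial⟩
  intro bp hbp
  simp only [tieOptions, argOptions, List.mem_append, List.mem_map] at hbp
  rcases hbp with ⟨r, -, rfl⟩ | ⟨r, -, rfl⟩ <;> trivial

theorem pickStep_writesN {a : ℕ} (h1 : a ≠ 1) (h5 : a ≠ 5) : ¬ (pickStep τs σ κ).WritesN a := by
  rintro (h | h | h)
  · refine firstOf_writesN ?_ h
    intro bp hbp
    simp only [tieOptions, argOptions, List.mem_append, List.mem_map] at hbp
    rcases hbp with ⟨r, -, rfl⟩ | ⟨r, -, rfl⟩ <;> exact h1.symm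
  · exact h5 h.symm
  · exact h

theorem pickStep_writesR : ¬ (pickStep τs σ κ).WritesR := by
  rintro (h | h | h)
  · refine firstOf_writesR ?_ h
    intro bp hbp
    simp only [tieOptions, argOptions, List.mem_append, List.mem_map] at hbp
    rcases hbp with ⟨r, -, rfl⟩ | ⟨r, -, rfl⟩ <;> exact id
  · exact h
  · exact h

theorem pickStep_emits : ¬ (pickStep τs σ κ).Emits := by
  rintro (h | h | h)
  · refine firstOf_emits ?_ h
    intro bp hbp
    simp only [tieOptions, argOptions, List.mem_append, List.mem_map] at hbp
    rcases hbp with ⟨r, -, rfl⟩ | ⟨r, -, rfl⟩ <;> exact id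
  · exact h
  · exact h

theorem fillProg_writesN {a : ℕ} (h1 : a ≠ 1) (h5 : a ≠ 5) (h7 : a ≠ 7) :
    ¬ (fillProg τs σ κ).WritesN a := by
  simp [fillProg, Prog.WritesN, pickStep_writesN τs σ κ h1 h5, h5.symm, h7.symm]

theorem fillProg_writesR : ¬ (fillProg τs σ κ).WritesR := by
  simp [fillProg, Prog.WritesR, pickStep_writesR]

theorem fillProg_emits : ¬ (fillProg τs σ κ).Emits := by
  simp [fillProg, Prog.Emits, pickStep_emits]

variable {τs σ κ}

theorem storeSign_congr {s s' : Store} (hR : s'.real = s.real)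
    (hn : ∀ a, 8 ≤ a → s'.nat a = s.nat a) : storeSign τs σ s' = storeSign τs σ s := by
  simp only [storeSign, hR, hn _ (Nat.le_add_right 8 _)]

open Classical in
theorem pickStep_run {s : Store} {sg : Form n d → ℕ → SignType} (hsg : storeSign τs σ s = sg)
    (h : ∃ j, ArgSign sg j (s.nat 7 0)) :
    ∃ v, IsChoice sg κ (s.nat 5 0) (s.nat 7 0) v ∧
      (pickStep τs σ κ).run s = if TiedSign sg (s.nat 7 0)
        then (s.writeN 1 (s.nat 7 0) v).writeN 5 0 (s.nat 5 0 + 1)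
        else s.writeN 1 (s.nat 7 0) v := by
  suffices hv : ∃ v, IsChoice sg κ (s.nat 5 0) (s.nat 7 0) v ∧
      (firstOf (tieOptions τs σ κ ++ argOptions τs σ)).run s = s.writeN 1 (s.nat 7 0) v by
    obtain ⟨v, hv, hrun⟩ := hv
    refine ⟨v, hv, ?_⟩
    have h2 : storeSign τs σ (s.writeN 1 (s.nat 7 0) v) = sg := by
      rw [← hsg]
      exact storeSign_congr rfl fun a ha => Store.writeN_nat_of_ne _ _ _ (by omega)
    rw [pickStep, Prog.run, hrun]
    simp [Prog.run, tiedTest_holds, h2, NExp.eval, Store.writeN_nat]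
  by_cases htie : ∃ r : Fin (maxTies n d), (r : ℕ) = s.nat 5 0 ∧ ArgSign sg (κ r) (s.nat 7 0)
  · obtain ⟨r, hr, hr'⟩ := htie
    obtain ⟨bp, hbp, hh, hrun⟩ := firstOf_append_run (s := s)
      (l := tieOptions τs σ κ) (l' := argOptions τs σ)
      ⟨_, List.mem_map.2 ⟨r, List.mem_finRange r, rfl⟩, by
        simp [BExp.Holds, argTest_holds, NExp.eval, hsg, hr, hr']⟩
    obtain ⟨r', -, rfl⟩ := List.mem_map.1 hbp
    simp only [BExp.Holds, eqTest_holds, argTest_holds, reg_eval, NExp.eval, hsg] at hh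
    refine ⟨κ r', ⟨κ r', rfl, hh.2, ?_⟩, hrun⟩
    intro r'' hr'' _
    rw [show r'' = r' from Fin.ext (hr''.trans hh.1)]
  · push Not at htie
    rw [firstOf_append_run_right]
    · obtain ⟨j, hj⟩ := h
      obtain ⟨bp, hbp, hh, hrun⟩ := firstOf_append_run (s := s)
        (l := argOptions τs σ) (l' := []) ⟨_, List.mem_map.2 ⟨j, List.mem_finRange j, rfl⟩, by
          simpa [argTest_holds, hsg] using hj⟩
      obtain ⟨j', -, rfl⟩ := List.mem_map.1 hbp
      simp only [argTest_holds, reg_eval, hsg] at hh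
      refine ⟨j', ⟨j', rfl, hh, fun r hr hr' => absurd hr' (htie r hr)⟩, ?_⟩
      rw [List.append_nil] at hrun
      exact hrun
    · intro bp hbp
      obtain ⟨r, -, rfl⟩ := List.mem_map.1 hbp
      simp only [BExp.Holds, eqTest_holds, argTest_holds, reg_eval, NExp.eval, hsg]
      exact fun hh => htie r hh.1.symm hh.2

open Classical in
/-- At every data point a label of minimal error is chosen, at the `r`-th tie as `κ r` says. -/
theorem fillProg_runs {s : Store} {sg : Form n d → ℕ → SignType} {N : ℕ} (hN : 1 ≤ N)
    (hs : s.nat 0 0 = N) (hsg : storeSign τs σ s = sg) (h : ∀ i < N, ∃ j, ArgSign sg j i) :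
    Runs (fillProg τs σ κ) s (3 + N * ((pickStep τs σ κ).bound + 19)) fun s' =>
      ∀ i < N, IsChoice sg κ (Nat.count (TiedSign sg) i) i (s'.nat 1 i) := by
  refine Runs.seq ⟨_, _, .setN _ _ _ _, le_rfl, ?_⟩
  refine (runs_forLoop (N := N) hN (by norm_num)
    (pickStep_writesN _ _ _ (by norm_num) (by norm_num))
    (pickStep_writesN _ _ _ (by norm_num) (by norm_num))
    (fun i s' => storeSign τs σ s' = sg ∧ s'.nat 5 0 = Nat.count (TiedSign sg) i ∧
      ∀ i' < i, IsChoice sg κ (Nat.count (TiedSign sg) i') i' (s'.nat 1 i'))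
    ?_ ?_ ?_ ?_).mono le_rfl fun s' h => h.2.2
  · rintro i s' v ⟨h1, h2, h3⟩
    refine ⟨?_, ?_, ?_⟩
    · rw [← h1]
      exact storeSign_congr rfl fun a ha => Store.writeN_nat_of_ne _ _ _ (by omega)
    · rwa [Store.writeN_nat_of_ne _ _ _ (by norm_num)]
    · rwa [Store.writeN_nat_of_ne _ _ _ (by norm_num)]
  · rintro i hi s' - hs'7 ⟨h1, h2, h3⟩
    refine ((pickStep_loopFree τs σ κ).runs_of
      (Q := fun s'' => s''.nat 5 0 = Nat.count (TiedSign sg) (i + 1) ∧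
        ∀ i' < i + 1, IsChoice sg κ (Nat.count (TiedSign sg) i') i' (s''.nat 1 i'))
      ?_).frame.mono le_rfl ?_
    · obtain ⟨v, hv, hrun⟩ := pickStep_run (κ := κ) h1 (by rw [hs'7]; exact h i hi)
      rw [hs'7, h2] at hv
      rw [hrun, hs'7, h2, Nat.count_succ]
      refine ⟨by split_ifs <;> simp [Store.writeN_nat, h2], fun i' hi' => ?_⟩
      rcases (Nat.lt_succ_iff.1 hi').eq_or_lt with rfl | hlt
      · split_ifs <;> simpa [Store.writeN_nat] using hv
      · split_ifs <;> simpa [Store.writeN_nat, hlt.ne] using h3 i' hlt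
    · rintro s'' ⟨⟨h4, h5⟩, hfr, hR, -⟩
      refine ⟨?_, h4, h5⟩
      rw [← h1]
      exact storeSign_congr (hR (pickStep_writesR _ _ _)) fun a ha =>
        hfr a (pickStep_writesN _ _ _ (by omega) (by omega))
  · rwa [Store.writeN_nat_of_ne _ _ _ (by norm_num)]
  · refine ⟨?_, by simp [Store.writeN_nat, NExp.eval], fun i' h => absurd h (Nat.not_lt_zero _)⟩
    rw [← hsg]
    exact storeSign_congr rfl fun a ha => Store.writeN_nat_of_ne _ _ _ (by omega)

end Fill

end Forms

/-! ### Keeping the classifications in a prefix tree -/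

/-- The array `a` holds a prefix tree with nodes `0, …, m` over the alphabet `0, …, n - 1`: the child
of the node `v` along the letter `j` is in the cell `n v + j`, which contains `0` if there is none,
and the node `v` stands for the word `path v`. -/
structure IsTrie (n : ℕ) (a : ℕ → ℕ) (m : ℕ) (path : ℕ → List ℕ) : Prop where
  root : path 0 = []
  fresh : ∀ v, m < v → ∀ j < n, a (n * v + j) = 0
  child : ∀ v ≤ m, ∀ j < n, a (n * v + j) ≠ 0 →
    a (n * v + j) ≤ m ∧ path (a (n * v + j)) = path v ++ [j]
  parent : ∀ v ≤ m, v ≠ 0 → ∃ u ≤ m, ∃ j < n, a (n * u + j) = v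
  inj : ∀ u ≤ m, ∀ v ≤ m, path u = path v → u = v

theorem mul_add_inj {n u v j k : ℕ} (hj : j < n) (hk : k < n) :
    n * u + j = n * v + k ↔ u = v ∧ j = k := by
  refine ⟨fun h => ?_, fun h => by rw [h.1, h.2]⟩
  have hn : 0 < n := by omega
  have h1 := congrArg (· / n) h
  have h2 := congrArg (· % n) h
  simp only [Nat.mul_add_div hn, Nat.div_eq_of_lt hj, Nat.div_eq_of_lt hk, add_zero,
    Nat.mul_add_mod, Nat.mod_eq_of_lt hj, Nat.mod_eq_of_lt hk] at h1 h2
  exact ⟨h1, h2⟩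

section Trie

variable {n m v j : ℕ} {a : ℕ → ℕ} {path : ℕ → List ℕ}

theorem isTrie_zero (n : ℕ) : IsTrie n (fun _ => 0) 0 fun _ => [] where
  root := rfl
  fresh _ _ _ _ := rfl
  child _ _ _ _ h := absurd rfl h
  parent _ h h' := absurd (Nat.le_zero.1 h) h'
  inj u hu v hv _ := by omega

/-- If the node `v` has no child along `j`, then no node stands for the word `path v ++ [j]`. -/
theorem IsTrie.path_ne (h : IsTrie n a m path) (hv : v ≤ m) (h0 : a (n * v + j) = 0) :
    ∀ u ≤ m, path u ≠ path v ++ [j] := by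
  intro u hu hp
  have hu0 : u ≠ 0 := by
    rintro rfl
    simp [h.root] at hp
  obtain ⟨u', hu', j', hj', rfl⟩ := h.parent u hu hu0
  rw [(h.child u' hu' j' hj' hu0).2] at hp
  obtain ⟨h1, h2⟩ := List.append_inj' hp rfl
  rw [h.inj u' hu' v hv h1, List.singleton_inj.1 h2] at hu0
  exact hu0 h0

/-- A missing child may be added as a new node. -/
theorem IsTrie.extend (h : IsTrie n a m path) (hv : v ≤ m) (hj : j < n)
    (h0 : a (n * v + j) = 0) :
    IsTrie n (Function.update a (n * v + j) (m + 1)) (m + 1)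
      (Function.update path (m + 1) (path v ++ [j])) := by
  have hpath : ∀ u ≤ m, Function.update path (m + 1) (path v ++ [j]) u = path u := fun u hu =>
    Function.update_of_ne (by omega) _ _
  refine ⟨(hpath 0 (Nat.zero_le _)).trans h.root, ?_, ?_, ?_, ?_⟩
  · intro u hu k hk
    rw [Function.update_of_ne, h.fresh u (by omega) k hk]
    rw [Ne, mul_add_inj hk hj]
    omega
  · intro u hu k hk
    by_cases huk : n * u + k = n * v + j
    · obtain ⟨rfl, rfl⟩ := (mul_add_inj hk hj).1 huk
      simp [hpath u hv]
    · rw [Function.update_of_ne huk]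
      intro hne
      have hum : u ≤ m := by
        by_contra hlt
        exact hne (h.fresh u (by omega) k hk)
      obtain ⟨h1, h2⟩ := h.child u hum k hk hne
      rw [hpath _ h1, hpath _ hum]
      exact ⟨by omega, h2⟩
  · intro u hu hu0
    rcases hu.eq_or_lt with rfl | hlt
    · exact ⟨v, by omega, j, hj, Function.update_self ..⟩
    · obtain ⟨u', hu', k, hk, rfl⟩ := h.parent u (by omega) hu0
      refine ⟨u', by omega, k, hk, Function.update_of_ne ?_ _ _⟩
      intro he
      rw [he] at hu0
      exact hu0 h0
  · intro u hu w hw he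
    rcases hu.eq_or_lt with rfl | hu <;> rcases hw.eq_or_lt with rfl | hw
    · rfl
    · rw [Function.update_self, hpath w (by omega)] at he
      exact absurd he.symm (h.path_ne hv h0 w (by omega))
    · rw [Function.update_self, hpath u (by omega)] at he
      exact absurd he (h.path_ne hv h0 u (by omega))
    · rw [hpath u (by omega), hpath w (by omega)] at he
      exact h.inj u (by omega) w (by omega) he

theorem exists_path_update_iff {l l' : List ℕ} :
    (∃ u ≤ m + 1, Function.update path (m + 1) l' u = l) ↔ (∃ u ≤ m, path u = l) ∨ l = l' := by
  constructor
  · rintro ⟨u, hu, rfl⟩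
    rcases hu.eq_or_lt with rfl | hlt
    · exact .inr (Function.update_self ..)
    · exact .inl ⟨u, by omega, (Function.update_of_ne (by omega) _ _).symm⟩
  · rintro (⟨u, hu, rfl⟩ | rfl)
    · exact ⟨u, by omega, Function.update_of_ne (by omega) _ _⟩
    · exact ⟨m + 1, le_rfl, Function.update_self ..⟩

end Trie

section Insert

variable {n N : ℕ}

/-- The word of a classification. -/
def word (q : Fin N → Fin n) : List ℕ := List.ofFn fun i => (q i : ℕ)

theorem word_injective : Function.Injective (word (n := n) (N := N)) := by
  intro q q' h
  funext i
  exact Fin.ext (congrFun (List.ofFn_injective h) i)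

theorem take_word (q : Fin N → Fin n) : (word q).take N = word q :=
  List.take_of_length_le (by simp [word])

theorem take_succ_word (q : Fin N → Fin n) {i : ℕ} (hi : i < N) :
    (word q).take (i + 1) = (word q).take i ++ [(q ⟨i, hi⟩ : ℕ)] := by
  rw [List.take_succ_eq_append_getElem (by simpa [word] using hi)]
  simp [word]

/-- The expression `k e`. -/
def scaleExp : ℕ → NExp → NExp
  | 0, _ => .const 0
  | k + 1, e => .add (scaleExp k e) e

@[simp] theorem scaleExp_eval (k : ℕ) (e : NExp) (s : Store) :
    (scaleExp k e).eval s = k * e.eval s := by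
  induction k with
  | zero => simp [scaleExp, NExp.eval]
  | succ k ih => simp [scaleExp, NExp.eval, ih, Nat.succ_mul]

/-- The cell for the child of the node in the register `4` along the letter in the cell of the
array `1` given by the register `7`. -/
def slotExp (n : ℕ) : NExp := .add (scaleExp n (reg 4)) (.cell 1 (reg 7))

/-- Go to that child, creating it if it does not exist; the register `6` tells whether it had to be
created. -/
def trieStep (n : ℕ) : Prog :=
  .seq
    (.branch (.ltN (.const 0) (.cell 2 (slotExp n)))
      (.setN 6 (.const 0) (.const 0))
      (.seq (.setN 3 (.const 0) (.add (reg 3) (.const 1)))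
        (.seq (.setN 2 (slotExp n) (reg 3)) (.setN 6 (.const 0) (.const 1)))))
    (.setN 4 (.const 0) (.cell 2 (slotExp n)))

/-- Insert the word in the array `1` into the prefix tree. -/
def insertProg (n : ℕ) : Prog :=
  .seq (.setN 4 (.const 0) (.const 0)) (forLoop 7 (trieStep n))

/-- Write the word in the array `1` to the output. -/
def emitProg : Prog := forLoop 7 (.emit (.cell 1 (reg 7)))

theorem trieStep_run (s : Store) {j : ℕ} (hj : s.nat 1 (s.nat 7 0) = j) :
    (trieStep n).run s = if s.nat 2 (n * s.nat 4 0 + j) ≠ 0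
      then (s.writeN 6 0 0).writeN 4 0 (s.nat 2 (n * s.nat 4 0 + j))
      else (((s.writeN 3 0 (s.nat 3 0 + 1)).writeN 2 (n * s.nat 4 0 + j)
        (s.nat 3 0 + 1)).writeN 6 0 1).writeN 4 0 (s.nat 3 0 + 1) := by
  by_cases h : s.nat 2 (n * s.nat 4 0 + j) = 0
  · simp [trieStep, Prog.run, BExp.Holds, NExp.eval, slotExp, hj, h, Store.writeN_nat]
  · simp [trieStep, Prog.run, BExp.Holds, NExp.eval, slotExp, hj, h, Store.writeN_nat,
      Nat.pos_of_ne_zero h]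

/-- The inserted word becomes a word of the prefix tree, and the last step tells whether it was
new: the word has full length, so it was there before if and only if its last node existed. -/
theorem insertProg_runs {s : Store} {path : ℕ → List ℕ} {L : Set (Fin N → Fin n)}
    {q : Fin N → Fin n} (hN : 1 ≤ N) (hs : s.nat 0 0 = N)
    (htrie : IsTrie n (s.nat 2) (s.nat 3 0) path)
    (hL : ∀ q' : Fin N → Fin n, (∃ v ≤ s.nat 3 0, path v = word q') ↔ q' ∈ L)
    (hq : ∀ i : Fin N, s.nat 1 i = q i) :
    Runs (insertProg n) s (3 + N * ((trieStep n).bound + 19)) fun s' =>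
      (s'.nat 6 0 ≠ 0 ↔ q ∉ L) ∧ ∃ path', IsTrie n (s'.nat 2) (s'.nat 3 0) path' ∧
        ∀ q' : Fin N → Fin n, (∃ v ≤ s'.nat 3 0, path' v = word q') ↔ q' ∈ L ∨ q' = q := by
  refine Runs.seq ⟨_, _, .setN _ _ _ _, le_rfl, ?_⟩
  refine (runs_forLoop (N := N) hN (by norm_num) (by simp [trieStep, Prog.WritesN])
    (by simp [trieStep, Prog.WritesN])
    (fun i s' => s'.nat 1 = s.nat 1 ∧ (i = N → (s'.nat 6 0 ≠ 0 ↔ q ∉ L)) ∧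
      ∃ path', IsTrie n (s'.nat 2) (s'.nat 3 0) path' ∧
        s'.nat 4 0 ≤ s'.nat 3 0 ∧ path' (s'.nat 4 0) = (word q).take i ∧
        ∀ q' : Fin N → Fin n, (∃ v ≤ s'.nat 3 0, path' v = word q') ↔ q' ∈ L ∨ (i = N ∧ q' = q))
    ?_ ?_ ?_ ?_).mono le_rfl ?_
  · intro i s' v h
    simpa only [Store.writeN_nat_of_ne _ _ _ (show 1 ≠ 7 by norm_num),
      Store.writeN_nat_of_ne _ _ _ (show 2 ≠ 7 by norm_num),
      Store.writeN_nat_of_ne _ _ _ (show 3 ≠ 7 by norm_num),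
      Store.writeN_nat_of_ne _ _ _ (show 4 ≠ 7 by norm_num),
      Store.writeN_nat_of_ne _ _ _ (show 6 ≠ 7 by norm_num)] using h
  · rintro i hi s' - hs'7 ⟨h1, -, path', htrie', hcur, hpath, hL'⟩
    have hi' : i ≠ N := hi.ne
    have hj : s'.nat 1 (s'.nat 7 0) = q ⟨i, hi⟩ := by rw [hs'7, h1]; exact hq ⟨i, hi⟩
    simp only [hi', false_and, or_false] at hL'
    have hword : i + 1 = N → (word q).take i ++ [(q ⟨i, hi⟩ : ℕ)] = word q := by
      intro h
      rw [← take_succ_word q hi, h, take_word]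
    refine Prog.LoopFree.runs_of (by simp [trieStep, Prog.LoopFree]) ?_
    rw [trieStep_run s' hj]
    by_cases h0 : s'.nat 2 (n * s'.nat 4 0 + q ⟨i, hi⟩) = 0
    · rw [if_neg (not_not.2 h0)]
      have hext := htrie'.extend hcur (q ⟨i, hi⟩).2 h0
      have hnot := htrie'.path_ne hcur h0
      rw [hpath] at hext hnot
      have hnat2 : ((((s'.writeN 3 0 (s'.nat 3 0 + 1)).writeN 2 (n * s'.nat 4 0 + q ⟨i, hi⟩)
          (s'.nat 3 0 + 1)).writeN 6 0 1).writeN 4 0 (s'.nat 3 0 + 1)).nat 2 =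
          Function.update (s'.nat 2) (n * s'.nat 4 0 + q ⟨i, hi⟩) (s'.nat 3 0 + 1) := by
        funext k
        simp [Store.writeN_nat, Function.update_apply]
      refine ⟨?_, ?_, Function.update path' (s'.nat 3 0 + 1)
        ((word q).take i ++ [(q ⟨i, hi⟩ : ℕ)]), ?_, ?_, ?_, ?_⟩
      · rw [← h1]
        funext k
        simp [Store.writeN_nat]
      · intro hiN
        refine iff_of_true (by simp [Store.writeN_nat]) ?_
        rw [← hL' q, ← hword hiN]
        rintro ⟨u, hu, hu'⟩
        exact hnot u hu hu'
      · rw [hnat2]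
        simpa [Store.writeN_nat] using hext
      · simp [Store.writeN_nat]
      · simp [Store.writeN_nat, take_succ_word q hi]
      · intro q'
        have : (((((s'.writeN 3 0 (s'.nat 3 0 + 1)).writeN 2 (n * s'.nat 4 0 + q ⟨i, hi⟩)
          (s'.nat 3 0 + 1)).writeN 6 0 1).writeN 4 0 (s'.nat 3 0 + 1)).nat 3 0) =
          s'.nat 3 0 + 1 := by simp [Store.writeN_nat]
        rw [this, exists_path_update_iff, hL']
        refine or_congr Iff.rfl ⟨fun h => ?_, fun h => ?_⟩
        · have hlen := congrArg List.length h
          simp [word] at hlen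
          have hiN : i + 1 = N := by omega
          exact ⟨hiN, word_injective (h.trans (hword hiN))⟩
        · rw [hword h.1, h.2]
    · rw [if_pos h0]
      obtain ⟨h2, h3⟩ := htrie'.child _ hcur _ (q ⟨i, hi⟩).2 h0
      rw [hpath] at h3
      have hmem : i + 1 = N → q ∈ L := fun hiN => (hL' q).1 ⟨_, h2, h3.trans (hword hiN)⟩
      have hn2 : ((s'.writeN 6 0 0).writeN 4 0 (s'.nat 2 (n * s'.nat 4 0 + q ⟨i, hi⟩))).nat 2 =
          s'.nat 2 := by
        rw [Store.writeN_nat_of_ne _ _ _ (by norm_num), Store.writeN_nat_of_ne _ _ _ (by norm_num)]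
      have hn3 : ((s'.writeN 6 0 0).writeN 4 0 (s'.nat 2 (n * s'.nat 4 0 + q ⟨i, hi⟩))).nat 3 =
          s'.nat 3 := by
        rw [Store.writeN_nat_of_ne _ _ _ (by norm_num), Store.writeN_nat_of_ne _ _ _ (by norm_num)]
      have hn4 : ((s'.writeN 6 0 0).writeN 4 0
          (s'.nat 2 (n * s'.nat 4 0 + q ⟨i, hi⟩))).nat 4 0 =
          s'.nat 2 (n * s'.nat 4 0 + q ⟨i, hi⟩) := by
        simp [Store.writeN_nat]
      refine ⟨?_, fun hiN => ?_, path', ?_, ?_, ?_, ?_⟩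
      · rw [← h1]
        funext k
        simp [Store.writeN_nat]
      · simpa [Store.writeN_nat] using hmem hiN
      · rwa [hn2, hn3]
      · rwa [hn3, hn4]
      · rw [hn4, h3, take_succ_word q hi]
      · intro q'
        rw [hn3, hL']
        refine ⟨.inl, ?_⟩
        rintro (h | ⟨h, rfl⟩)
        · exact h
        · exact hmem h
  · rwa [Store.writeN_nat_of_ne _ _ _ (by norm_num)]
  · refine ⟨?_, fun h => by omega, path, ?_, ?_, ?_, ?_⟩
    · rw [Store.writeN_nat_of_ne _ _ _ (by norm_num)]
    · rwa [Store.writeN_nat_of_ne _ _ _ (by norm_num), Store.writeN_nat_of_ne _ _ _ (by norm_num)]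
    · simp [Store.writeN_nat, NExp.eval]
    · simp [Store.writeN_nat, NExp.eval, htrie.root]
    · intro q'
      rw [Store.writeN_nat_of_ne _ _ _ (by norm_num), hL]
      simp only [show (0 : ℕ) ≠ N by omega, false_and, or_false]
  · rintro s' ⟨-, h2, path', h3, -, -, h4⟩
    exact ⟨h2 rfl, path', h3, by simpa using h4⟩

theorem emitProg_runs {s : Store} {q : Fin N → Fin n} (hN : 1 ≤ N) (hs : s.nat 0 0 = N)
    (hq : ∀ i : Fin N, s.nat 1 i = q i) :
    Runs emitProg s (N * (5 + 19)) fun s' => s'.out = s.out ++ word q := by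
  refine (runs_forLoop (N := N) hN (by norm_num) (by simp [Prog.WritesN])
    (by simp [Prog.WritesN])
    (fun i s' => s'.nat 1 = s.nat 1 ∧ s'.out = s.out ++ (word q).take i) ?_ ?_ hs ?_).mono
    le_rfl ?_
  · rintro i s' v ⟨h1, h2⟩
    exact ⟨by rw [Store.writeN_nat_of_ne _ _ _ (by norm_num), h1], h2⟩
  · rintro i hi s' - hs'7 ⟨h1, h2⟩
    refine ⟨_, _, .emit _ _, by simp [NExp.cost, reg], h1, ?_⟩
    have : s'.nat 1 i = q ⟨i, hi⟩ := by rw [h1]; exact hq ⟨i, hi⟩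
    simp [NExp.eval, hs'7, this, h2, take_succ_word q hi]
  · simp
  · rintro s' ⟨-, h⟩
    rw [h, take_word]

end Insert

/-! ### The program -/

section Program

variable {n d N : ℕ}

/-- The program has written the elements of `X` to the output, and they are the words of length `N`
in the prefix tree; the data are intact. -/
structure Records (R : ℕ → ℕ → ℝ) (X : Set (Fin N → Fin n)) (s : Store) : Prop where
  size : s.nat 0 0 = N
  data : s.real = R
  trie : ∃ path, IsTrie n (s.nat 2) (s.nat 3 0) path ∧
    ∀ q : Fin N → Fin n, (∃ v ≤ s.nat 3 0, path v = word q) ↔ q ∈ X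
  lists : Lists s.out X

theorem Records.writeN {R : ℕ → ℕ → ℝ} {X : Set (Fin N → Fin n)} {s : Store}
    (h : Records R X s) (a i v : ℕ) (ha : 4 ≤ a) : Records R X (s.writeN a i v) where
  size := by rw [Store.writeN_nat_of_ne _ _ _ (by omega), h.size]
  data := h.data
  trie := by
    rw [Store.writeN_nat_of_ne _ _ _ (by omega), Store.writeN_nat_of_ne _ _ _ (by omega)]
    exact h.trie
  lists := h.lists

theorem lists_insert {o : List ℕ} {X : Set (Fin N → Fin n)} {q : Fin N → Fin n} (h : Lists o X)
    (hq : q ∉ X) : Lists (o ++ word q) (insert q X) := by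
  obtain ⟨L, h1, h2, rfl⟩ := h
  refine ⟨L ++ [q], ?_, fun q' => ?_, by simp [word]⟩
  · rw [List.nodup_append]
    refine ⟨h1, List.nodup_singleton q, ?_⟩
    intro a ha b hb hab
    rw [List.mem_singleton.1 hb] at hab
    exact hq ((h2 q).1 (hab ▸ ha))
  · rw [List.mem_append, List.mem_singleton, h2, Set.mem_insert_iff, or_comm]

open Classical in
/-- The classification which breaks ties according to `κ`, as a set with at most one element. -/
def tieBreak (sg : Form n d → ℕ → SignType) (κ : Fin (maxTies n d) → Fin n) :
    Set (Fin N → Fin n) :=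
  {q | ValidSign sg ∧ (∀ i, ArgSign sg (q i) i) ∧ ∀ i : Fin N, TiedSign sg i →
    ∃ r : Fin (maxTies n d), (r : ℕ) = Nat.count (TiedSign sg) i ∧ κ r = q i}

section Body

variable (τs : Fin (dim n d) → Form n d) (σ : Fin (dim n d) → SignType)
  (κ : Fin (maxTies n d) → Fin n)

/-- If the face given by the loop registers consists of tuples of distinct parameter vectors,
compute a classification and write it to the output unless it is there already. -/
noncomputable def bodyProg : Prog :=
  .branch (validTest τs σ)
    (.seq (fillProg τs σ κ) (.seq (insertProg n)
      (.branch (.ltN (.const 0) (reg 6)) emitProg .skip))) .skip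

/-- The running time of `bodyProg` is at most `N` times this constant. -/
noncomputable def bodyBound : ℕ :=
  (validTest τs σ).cost + (pickStep τs σ κ).bound + (trieStep n).bound + 100

theorem bodyProg_writesN {a : ℕ} (ha : a = 0 ∨ 8 ≤ a) : ¬ (bodyProg τs σ κ).WritesN a := by
  have h := fillProg_writesN τs σ κ (a := a) (by omega) (by omega) (by omega)
  simp only [bodyProg, Prog.WritesN, insertProg, emitProg, forLoop_writesN, trieStep, h,
    or_false, false_or]
  omega

theorem insertProg_writesN {a : ℕ} (ha : a < 2 ∨ 8 ≤ a) : ¬ (insertProg n).WritesN a := by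
  simp only [Prog.WritesN, insertProg, forLoop_writesN, trieStep]
  omega

variable {τs σ κ}

/-- If every labelling of minimal error on a face with distinct parameter vectors belongs to `Q`,
then the program only writes elements of `Q`, among them the one that breaks ties as `κ` does. -/
theorem bodyProg_runs {R : ℕ → ℕ → ℝ} {Q X : Set (Fin N → Fin n)} {s : Store} (hN : 1 ≤ N)
    {ι : Fin (dim n d) → Fin N} (hι : ∀ j : Fin (dim n d), s.nat (8 + j) 0 = ι j)
    (hsg : ValidSign (flagSign R τs σ fun r => ι r) →
      (∀ i < N, ∃ j, ArgSign (flagSign R τs σ fun r => ι r) j i) ∧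
      ∀ q : Fin N → Fin n, (∀ i, ArgSign (flagSign R τs σ fun r => ι r) (q i) i) → q ∈ Q)
    (hX : Records R X s) (hXQ : X ⊆ Q) :
    Runs (bodyProg τs σ κ) s (N * bodyBound τs σ κ) fun s' =>
      ∃ X', X ⊆ X' ∧ tieBreak (flagSign R τs σ fun r => ι r) κ ⊆ X' ∧
        Records R X' s' ∧ X' ⊆ Q := by
  have hstore : storeSign τs σ s = flagSign R τs σ fun r => ι r := by
    rw [storeSign, hX.data]
    simp only [hι]
  by_cases hv : ValidSign (flagSign R τs σ fun r => ι r)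
  swap
  · refine (Runs.branch_false (by rwa [validTest_holds, hstore])
      (⟨_, _, .skip s, le_rfl, X, subset_rfl, fun q hq => absurd hq.1 hv, hX, hXQ⟩ :
        Runs .skip s 1 _)).mono ?_ fun _ h => h
    rw [bodyBound]
    nlinarith
  obtain ⟨harg, hQ⟩ := hsg hv
  refine (Runs.branch_true (by rwa [validTest_holds, hstore]) (Runs.seq
    ((fillProg_runs (κ := κ) hN hX.size hstore harg).frame.mono le_rfl
      (Q' := fun s' => Runs _ s' (3 + N * ((trieStep n).bound + 19) + (4 + N * (5 + 19) + 1)) _)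
      ?_))).mono
    ?_ fun _ h => h
  swap
  · rw [bodyBound]
    nlinarith
  rintro s₁ ⟨hchoice, hfr, hR, hout⟩
  choose q hq hqarg hqκ using fun i : Fin N => hchoice i i.2
  have hfr' : ∀ a, a ≠ 1 → a ≠ 5 → a ≠ 7 → s₁.nat a = s.nat a := fun a h1 h5 h7 =>
    hfr a (fillProg_writesN _ _ _ h1 h5 h7)
  have hsize : s₁.nat 0 0 = N := by rw [hfr' 0 (by norm_num) (by norm_num) (by norm_num), hX.size]
  have htie : tieBreak (flagSign R τs σ fun r => ι r) κ ⊆ {q} := by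
    rintro q' ⟨-, h1, h2⟩
    funext i
    by_cases ht : TiedSign (flagSign R τs σ fun r => ι r) i
    · obtain ⟨r, hr, hr'⟩ := h2 i ht
      rw [← hr']
      exact (hqκ i r hr (by rw [hr']; exact h1 i)).symm
    · by_contra hne
      exact ht ⟨_, _, hne, h1 i, hqarg i⟩
  obtain ⟨path, htrie, hpath⟩ := hX.trie
  rw [← hfr' 2 (by norm_num) (by norm_num) (by norm_num),
    ← hfr' 3 (by norm_num) (by norm_num) (by norm_num)] at htrie
  rw [← hfr' 3 (by norm_num) (by norm_num) (by norm_num)] at hpath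
  refine Runs.seq ((insertProg_runs hN hsize htrie hpath hq).frame.mono le_rfl ?_)
  rintro s₂ ⟨⟨hnew, htrie₂⟩, hfr₂, hR₂, hout₂⟩
  have hsize₂ : s₂.nat 0 0 = N := by rw [hfr₂ 0 (insertProg_writesN (by norm_num)), hsize]
  have hword₂ : ∀ i : Fin N, s₂.nat 1 i = q i := fun i => by
    rw [hfr₂ 1 (insertProg_writesN (by norm_num)), hq]
  have hdata₂ : s₂.real = R := by
    rw [hR₂ (by simp [insertProg, trieStep, Prog.WritesR]), hR (fillProg_writesR _ _ _), hX.data]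
  have hlists₂ : Lists s₂.out X := by
    rw [hout₂ (by simp [insertProg, trieStep, Prog.Emits]), hout (fillProg_emits _ _ _)]
    exact hX.lists
  have htrie₂' : ∃ path, IsTrie n (s₂.nat 2) (s₂.nat 3 0) path ∧
      ∀ q' : Fin N → Fin n, (∃ v ≤ s₂.nat 3 0, path v = word q') ↔ q' ∈ insert q X := by
    obtain ⟨path', h1, h2⟩ := htrie₂
    exact ⟨path', h1, fun q' => by rw [h2, Set.mem_insert_iff, or_comm]⟩
  have hsub : tieBreak (flagSign R τs σ fun r => ι r) κ ⊆ insert q X :=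
    htie.trans (Set.singleton_subset_iff.2 (Set.mem_insert q X))
  have hsubQ : insert q X ⊆ Q := Set.insert_subset (hQ q hqarg) hXQ
  by_cases hqX : q ∈ X
  · refine (Runs.branch_false (T := 1) ?_ ⟨_, _, .skip _, le_rfl, insert q X,
      Set.subset_insert _ _, hsub, ⟨hsize₂, hdata₂, htrie₂', ?_⟩, hsubQ⟩).mono ?_ fun _ h => h
    · simpa [BExp.Holds, NExp.eval, hqX] using hnew
    · simp only [BExp.cost, NExp.cost, reg]
      omega
    · rwa [Set.insert_eq_of_mem hqX]
  · refine (Runs.branch_true ?_ ((emitProg_runs hN hsize₂ hword₂).frame.mono le_rfl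
      ?_)).mono ?_ fun _ h => h
    · simpa [BExp.Holds, NExp.eval, hqX, Nat.pos_iff_ne_zero] using hnew
    · rintro s₃ ⟨hout₃, hfr₃, hR₃, -⟩
      have hfr₃' : ∀ a, a ≠ 7 → s₃.nat a = s₂.nat a := fun a ha =>
        hfr₃ a (by simp [emitProg, Prog.WritesN, ha.symm])
      refine ⟨insert q X, Set.subset_insert _ _, hsub, ⟨?_, ?_, ?_, ?_⟩, hsubQ⟩
      · rw [hfr₃' 0 (by norm_num), hsize₂]
      · rw [hR₃ (by simp [emitProg, Prog.WritesR]), hdata₂]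
      · rwa [hfr₃' 2 (by norm_num), hfr₃' 3 (by norm_num)]
      · rw [hout₃]
        exact lists_insert hlists₂ hqX
    · simp only [BExp.cost, NExp.cost, reg]
      omega

end Body

/-- What the program text runs through: the forms and signs of a flag, and ways to break ties. -/
abbrev Param (n d : ℕ) : Type :=
  (Fin (dim n d) → Form n d) × (Fin (dim n d) → SignType) × (Fin (maxTies n d) → Fin n)

/-- For all forms, signs, ways to break ties and tuples of data points, treat the classification
given by them. -/
noncomputable def mainProg (n d : ℕ) : Prog :=
  seqAll ((Finset.univ : Finset (Param n d)).toList.map fun p =>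
    nest (bodyProg p.1 p.2.1 p.2.2) (dim n d))

/-- The running time of `mainProg` is at most `N ^ (dim n d + 1)` times this constant. -/
noncomputable def mainBound (n d : ℕ) : ℕ :=
  (Finset.univ : Finset (Param n d)).toList.length *
    ((Finset.univ : Finset (Param n d)).sup (fun p => bodyBound p.1 p.2.1 p.2.2) +
      19 * dim n d) + 1

/-- If the labellings of minimal error on the faces with distinct parameter vectors belong to `Q`,
and every element of `Q` is obtained by some flag and way to break ties, then the program lists
`Q`. -/
theorem mainProg_runs {R : ℕ → ℕ → ℝ} {Q : Set (Fin N → Fin n)} {s : Store} (hN : 1 ≤ N)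
    (hsound : ∀ (τs : Fin (dim n d) → Form n d) (σ : Fin (dim n d) → SignType)
      (ι : Fin (dim n d) → Fin N), ValidSign (flagSign R τs σ fun r => ι r) →
      (∀ i < N, ∃ j, ArgSign (flagSign R τs σ fun r => ι r) j i) ∧
      ∀ q : Fin N → Fin n, (∀ i, ArgSign (flagSign R τs σ fun r => ι r) (q i) i) → q ∈ Q)
    (hcomplete : ∀ q ∈ Q, ∃ (τs : Fin (dim n d) → Form n d) (σ : Fin (dim n d) → SignType)
      (ι : Fin (dim n d) → Fin N) (κ : Fin (maxTies n d) → Fin n),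
      q ∈ tieBreak (flagSign R τs σ fun r => ι r) κ)
    (hs : Records R (∅ : Set (Fin N → Fin n)) s) :
    Runs (mainProg n d) s (mainBound n d * N ^ (dim n d + 1)) fun s' => Lists s'.out Q := by
  set B : ℕ := (Finset.univ : Finset (Param n d)).sup (fun p => bodyBound p.1 p.2.1 p.2.2)
  refine (runs_seqAll_collect (fun X s => Records R X s ∧ X ⊆ Q)
    (C := fun p => ⋃ ι : Fin (dim n d) → Fin N,
      tieBreak (flagSign R p.1 p.2.1 fun r => ι r) p.2.2)
    (T := N ^ dim n d * (N * B + 19 * dim n d)) ?_ ∅ s ⟨hs, Set.empty_subset Q⟩).mono ?_ ?_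
  · rintro p - X s hX
    refine (runs_nest_collect (fun X s => Records R X s ∧ X ⊆ Q)
      (C := fun ι : Fin (dim n d) → Fin N => tieBreak (flagSign R p.1 p.2.1 fun r => ι r) p.2.2)
      hN (fun X s h => h.1.size) (fun X s a v ha h => ⟨h.1.writeN a 0 v (by omega), h.2⟩)
      (fun a ha => bodyProg_writesN _ _ _ ha)
      (fun X s ι h hι => bodyProg_runs hN hι (hsound _ _ ι) h.1 h.2) (dim n d) le_rfl X s hX
      (fun j hj => absurd j.2 (not_lt.2 hj))).mono ?_ ?_
    · have : bodyBound p.1 p.2.1 p.2.2 ≤ B :=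
        Finset.le_sup (f := fun p : Param n d => bodyBound p.1 p.2.1 p.2.2) (Finset.mem_univ p)
      gcongr
    · rintro s' ⟨X', h1, h2, h3⟩
      exact ⟨X', h1, Set.iUnion_subset fun ι => h2 ι fun j hj => absurd j.2 (not_lt.2 hj), h3⟩
  · have h1 : 1 ≤ N ^ (dim n d + 1) := Nat.one_le_pow _ _ hN
    have h2 : N ^ dim n d * (N * B + 19 * dim n d) ≤ (B + 19 * dim n d) * N ^ (dim n d + 1) := by
      rw [pow_succ]
      have : 19 * dim n d ≤ N * (19 * dim n d) := Nat.le_mul_of_pos_left _ hN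
      calc N ^ dim n d * (N * B + 19 * dim n d)
          ≤ N ^ dim n d * (N * B + N * (19 * dim n d)) := by gcongr
        _ = _ := by ring
    rw [mainBound, add_mul, one_mul, mul_assoc]
    gcongr
  · rintro s' ⟨X', -, h2, h3, h4⟩
    have : X' = Q := by
      refine h4.antisymm fun q hq => ?_
      obtain ⟨τs, σ, ι, κ, h⟩ := hcomplete q hq
      exact h2 (τs, σ, κ) (Finset.mem_toList.2 (Finset.mem_univ _)) (Set.mem_iUnion.2 ⟨ι, h⟩)
    exact this ▸ h3.lists

/-! ### Soundness and completeness for data in general position -/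

theorem validSign_congr {sg sg' : Form n d → ℕ → SignType} (h : ∀ τ, sg τ 0 = sg' τ 0) :
    ValidSign sg ↔ ValidSign sg' := by
  simp only [ValidSign, h]

theorem argSign_congr {sg sg' : Form n d → ℕ → SignType} {i : ℕ} (h : ∀ τ, sg τ i = sg' τ i)
    (j : Fin n) : ArgSign sg j i ↔ ArgSign sg' j i := by
  simp only [ArgSign, LeSign, h]

section Data

variable (x : Fin N → Fin d → ℝ) (y : Fin N → ℝ)

theorem inputStore_real_x (i : Fin N) (c : Fin d) : (inputStore x y).real c i = x i c := by
  have h : (i : ℕ) < N ∧ (c : ℕ) < d + 1 := ⟨i.2, by omega⟩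
  simp only [inputStore, dif_pos h, joint]
  exact Fin.snoc_castSucc (α := fun _ => ℝ) (y i) (x i) c

theorem inputStore_real_y (i : Fin N) : (inputStore x y).real d i = y i := by
  have h : (i : ℕ) < N ∧ d < d + 1 := ⟨i.2, by omega⟩
  simp only [inputStore, dif_pos h, joint]
  exact Fin.snoc_last (α := fun _ => ℝ) (y i) (x i)

theorem records_inputStore (hN : 1 ≤ N) :
    Records (inputStore x y).real (∅ : Set (Fin N → Fin n)) (inputStore x y) where
  size := by simp [inputStore]
  data := rfl
  trie := by
    refine ⟨fun _ => [], ?_, fun q => ?_⟩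
    · have h2 : (inputStore x y).nat 2 = fun _ => 0 := by
        funext i
        simp [inputStore]
      have h3 : (inputStore x y).nat 3 0 = 0 := by simp [inputStore]
      rw [h2, h3]
      exact isTrie_zero n
    · refine ⟨?_, fun h => h.elim⟩
      rintro ⟨v, -, hv⟩
      have := congrArg List.length hv
      simp [word] at this
      omega
  lists := ⟨[], List.nodup_nil, by simp, rfl⟩

variable {x y}

theorem argSign_inputStore {ℓ : ℝ → ℝ} (hℓ : IsLoss ℓ) {W : Fin (dim n d) → ℝ}
    (ht : 0 < homVar W) (j : Fin n) (i : Fin N) :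
    ArgSign (pointSign (inputStore x y).real W) j i ↔ ∀ k,
      ℓ (y i - ((homVar W)⁻¹ • parVec W j) ⬝ᵥ x i) ≤
        ℓ (y i - ((homVar W)⁻¹ • parVec W k) ⬝ᵥ x i) := by
  rw [argSign_pointSign hℓ ht, inputStore_real_y,
    show (fun c : Fin d => (inputStore x y).real c i) = x i from
      funext fun c => inputStore_real_x x y i c]

/-- What the program finds on a face is a minimum-error classification: that of a point of the
face, scaled to `t = 1`. -/
theorem sound_inputStore {ℓ : ℝ → ℝ} (hℓ : IsLoss ℓ) (hn : 1 ≤ n) (hN : 1 ≤ N)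
    (τs : Fin (dim n d) → Form n d) (σ : Fin (dim n d) → SignType) (ι : Fin (dim n d) → ℕ)
    (hv : ValidSign (flagSign (inputStore x y).real τs σ ι)) :
    (∀ i < N, ∃ j, ArgSign (flagSign (inputStore x y).real τs σ ι) j i) ∧
      ∀ q : Fin N → Fin n, (∀ i, ArgSign (flagSign (inputStore x y).real τs σ ι) (q i) i) →
        q ∈ minErr ℓ n x y := by
  obtain ⟨W, hW⟩ := exists_pointSign_eq_flagSign (inputStore x y).real N τs σ ι
  obtain ⟨ht, hinj⟩ := validSign_pointSign.1 ((validSign_congr fun τ => hW τ 0 hN).1 hv)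
  refine ⟨fun i hi => ?_, fun q hq => ?_⟩
  · obtain ⟨j, hj⟩ := exists_argSign_pointSign (R := (inputStore x y).real) hn ht i
    exact ⟨j, (argSign_congr (fun τ => hW τ i hi) j).2 hj⟩
  · refine ⟨fun j => (homVar W)⁻¹ • parVec W j, fun j k hjk => ?_, fun i => ?_⟩
    · exact hinj (smul_right_injective _ (inv_ne_zero ht.ne') hjk)
    · exact (argSign_inputStore hℓ ht (q i) i).1
        ((argSign_congr (fun τ => hW τ i i.2) (q i)).1 (hq i))

/-- In general position, at most `maxTies n d` data points lie on one of the hyperplanes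
`(w_j - w_k) · x = 0` and `2 y = (w_j + w_k) · x`. -/
theorem ncard_ties_le (h : DataGeneralPosition x y) {w : Fin n → Fin d → ℝ}
    (hw : Function.Injective w) :
    {i : Fin N | ∃ j k, j ≠ k ∧ |y i - w j ⬝ᵥ x i| = |y i - w k ⬝ᵥ x i|}.ncard ≤
      maxTies n d := by
  classical
  have hpair : ∀ j k, j ≠ k →
      {i : Fin N | |y i - w j ⬝ᵥ x i| = |y i - w k ⬝ᵥ x i|}.ncard ≤ 2 * d + 1 := by
    intro j k hjk
    have h1 := h.1 (w j - w k) 0 (sub_ne_zero.2 fun h => hjk (hw h))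
    have h2 := h.2 (Fin.snoc (α := fun _ => ℝ) (-(w j + w k)) 2) 0 (fun h0 => by
      have := congrFun h0 (Fin.last d)
      simp at this)
    refine (Set.ncard_le_ncard ?_ (Set.toFinite _)).trans
      ((Set.ncard_union_le _ _).trans ((add_le_add h1 h2).trans (by omega)))
    intro i hi
    rcases abs_eq_abs.1 (show |y i - w j ⬝ᵥ x i| = |y i - w k ⬝ᵥ x i| from hi) with h | h
    · left
      simp only [Set.mem_ofPred_eq, sub_dotProduct]
      linarith
    · right
      have : Fin.snoc (α := fun _ => ℝ) (-(w j + w k)) 2 ⬝ᵥ joint x y i =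
          -(w j + w k) ⬝ᵥ x i + 2 * y i := by
        rw [dotProduct, Fin.sum_univ_castSucc]
        simp [joint, dotProduct]
      simp only [Set.mem_ofPred_eq, this, neg_dotProduct, add_dotProduct]
      linarith
  let P : Finset (Fin n × Fin n) := Finset.univ.filter fun jk => jk.1 ≠ jk.2
  let T : Fin n × Fin n → Finset (Fin N) := fun jk =>
    Finset.univ.filter fun i => |y i - w jk.1 ⬝ᵥ x i| = |y i - w jk.2 ⬝ᵥ x i|
  have hset : {i : Fin N | ∃ j k, j ≠ k ∧ |y i - w j ⬝ᵥ x i| = |y i - w k ⬝ᵥ x i|} =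
      ↑(P.biUnion T) := by
    ext i
    simp [P, T]
  rw [hset, Set.ncard_coe_finset]
  refine (Finset.card_biUnion_le_card_mul P T (2 * d + 1) fun jk hjk => ?_).trans
    (Nat.mul_le_mul_right _ ?_)
  · have := hpair jk.1 jk.2 (by simpa [P] using hjk)
    rwa [← Set.ncard_coe_finset, Finset.coe_filter_univ]
  · exact (Finset.card_le_univ P).trans (by simp)

/-- Every minimum-error classification is found: on the face of its parameter vectors, with the
ties broken as the classification does. General position bounds the number of ties. -/
theorem complete_inputStore {ℓ : ℝ → ℝ} (hℓ : IsLoss ℓ) (hn : 1 ≤ n) (hN : 1 ≤ N)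
    (h : DataGeneralPosition x y) {q : Fin N → Fin n} (hq : q ∈ minErr ℓ n x y) :
    ∃ (τs : Fin (dim n d) → Form n d) (σ : Fin (dim n d) → SignType)
      (ι : Fin (dim n d) → Fin N) (κ : Fin (maxTies n d) → Fin n),
      q ∈ tieBreak (flagSign (inputStore x y).real τs σ fun r => ι r) κ := by
  classical
  obtain ⟨w, hw, hmin⟩ := hq
  let W : Fin (dim n d) → ℝ := fun b => (varEquiv n d b).elim 1 fun jc => w jc.1 jc.2
  have ht : homVar W = 1 := by simp [homVar, W]
  have hpar : parVec W = w := by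
    funext j c
    simp [parVec, W]
  have ht0 : 0 < homVar W := by rw [ht]; exact one_pos
  obtain ⟨τs, σ, ι, hsg⟩ := exists_flagSign_eq_pointSign (inputStore x y).real hN W
  set sg := flagSign (inputStore x y).real τs σ fun r => ι r
  have harg : ∀ j (i : Fin N), ArgSign sg j i ↔
      ∀ k, ℓ (y i - w j ⬝ᵥ x i) ≤ ℓ (y i - w k ⬝ᵥ x i) := by
    intro j i
    rw [argSign_congr (fun τ => hsg τ i i.2), argSign_inputStore hℓ ht0, hpar, ht]
    simp only [inv_one, one_smul]
  have hcard : Nat.count (TiedSign sg) N ≤ maxTies n d := by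
    refine le_trans ?_ (ncard_ties_le h hw)
    rw [Nat.count_eq_card_filter_range, ← Set.ncard_coe_finset,
      ← Set.ncard_image_of_injective _ Fin.val_injective]
    refine Set.ncard_le_ncard ?_ (Set.toFinite _)
    intro i hi
    simp only [Finset.coe_filter, Finset.mem_range, Set.mem_ofPred_eq] at hi
    obtain ⟨hiN, j, k, hjk, hj, hk⟩ := hi
    refine ⟨⟨i, hiN⟩, ⟨j, k, hjk, ?_⟩, rfl⟩
    have h1 := (harg j ⟨i, hiN⟩).1 hj k
    have h2 := (harg k ⟨i, hiN⟩).1 hk j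
    rw [← not_lt, hℓ.lt_iff, not_lt] at h1 h2
    exact h1.antisymm h2
  -- The `r`-th tie is broken as `q` does.
  let κ : Fin (maxTies n d) → Fin n := fun r =>
    if hr : ∃ i : Fin N, TiedSign sg i ∧ Nat.count (TiedSign sg) i = r then q hr.choose
    else ⟨0, hn⟩
  refine ⟨τs, σ, ι, κ, ?_, fun i => (harg _ _).2 (hmin i), fun i hi => ?_⟩
  · rw [validSign_congr fun τ => hsg τ 0 hN, validSign_pointSign, hpar]
    exact ⟨ht0, hw⟩
  · have hlt : Nat.count (TiedSign sg) i < maxTies n d :=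
      (Nat.count_strict_mono hi i.2).trans_le hcard
    have hex : ∃ i' : Fin N, TiedSign sg i' ∧ Nat.count (TiedSign sg) i' =
        ((⟨Nat.count (TiedSign sg) i, hlt⟩ : Fin (maxTies n d)) : ℕ) := ⟨i, hi, rfl⟩
    refine ⟨⟨Nat.count (TiedSign sg) i, hlt⟩, by congr!, ?_⟩
    simp only [κ, dif_pos hex]
    congr 1
    exact Fin.ext (Nat.count_injective hex.choose_spec.1 hi hex.choose_spec.2)

end Data

theorem length_of_lists {o : List ℕ} {Q : Set (Fin N → Fin n)} (h : Lists o Q) :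
    o.length = Q.ncard * N := by
  obtain ⟨L, hnd, hmem, rfl⟩ := h
  classical
  have hQ : Q = ↑L.toFinset := by
    ext q
    simp [hmem]
  rw [hQ, Set.ncard_coe_finset, List.toFinset_card_of_nodup hnd, List.length_flatten]
  simp [Function.comp_def]

/-- The bound on the number of classifications follows from the running time, as they have to be
written down. -/
theorem maxCount_le {ℓ : ℝ → ℝ} {n d N T : ℕ} (hN : 1 ≤ N) {P : Prog}
    (hP : ∀ (x : Fin N → Fin d → ℝ) (y : Fin N → ℝ), DataGeneralPosition x y →
      Runs P (inputStore x y) T fun s => Lists s.out (minErr ℓ n x y)) :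
    maxCount ℓ d n N ≤ T := by
  rcases Set.eq_empty_or_nonempty (minErrCounts ℓ d n N) with h | h
  · rw [maxCount, h, csSup_empty]
    exact Nat.zero_le _
  · refine csSup_le h ?_
    rintro c ⟨x, y, hxy, rfl⟩
    obtain ⟨t, s, he, ht, hl⟩ := hP x y hxy
    have h1 := he.length_out_le
    rw [length_of_lists hl] at h1
    have h2 : (inputStore x y).out.length = 0 := rfl
    have h3 := Nat.le_mul_of_pos_right (minErr ℓ n x y).ncard hN
    omega

end Program

end SwitchReg

theorem theorem3 (d n : ℕ) (hd : 1 ≤ d) (hn : 2 ≤ n) (ℓ : ℝ → ℝ) (hℓ : SwitchReg.IsLoss ℓ) :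
    Asymptotics.IsBigO Filter.atTop
        (fun N : ℕ => (SwitchReg.maxCount ℓ d n N : ℝ))
        (fun N : ℕ => (N : ℝ) ^ (2 * d * n * (n - 1))) ∧
    ∃ (P : SwitchReg.Prog) (C : ℕ), ∀ N : ℕ, 1 ≤ N →
      ∀ (x : Fin N → Fin d → ℝ) (y : Fin N → ℝ), SwitchReg.DataGeneralPosition x y →
        ∃ (t : ℕ) (s : SwitchReg.Store), SwitchReg.Exec P (SwitchReg.inputStore x y) t s ∧
          t ≤ C * N ^ (2 * d * n * (n - 1)) ∧
          SwitchReg.Lists s.out (SwitchReg.minErr ℓ n x y) := by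
  open SwitchReg in
  have key : ∀ N : ℕ, 1 ≤ N → ∀ (x : Fin N → Fin d → ℝ) (y : Fin N → ℝ),
      DataGeneralPosition x y → Runs (mainProg n d) (inputStore x y)
        (mainBound n d * N ^ (2 * d * n * (n - 1))) fun s => Lists s.out (minErr ℓ n x y) := by
    intro N hN x y hxy
    refine (mainProg_runs hN
      (fun τs σ ι hv => sound_inputStore hℓ (by omega) hN τs σ _ hv)
      (fun q hq => complete_inputStore hℓ (by omega) hN hxy hq)
      (records_inputStore x y hN)).mono (Nat.mul_le_mul_left _ ?_) fun _ h => h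
    refine Nat.pow_le_pow_right hN ?_
    have h1 : 2 ≤ n * d := le_trans hn (Nat.le_mul_of_pos_right n hd)
    have h2 : 2 * d * n ≤ 2 * d * n * (n - 1) := Nat.le_mul_of_pos_right _ (by omega)
    have h3 : 2 * d * n = n * d + n * d := by ring
    rw [dim]
    omega
  refine ⟨?_, SwitchReg.mainProg n d, SwitchReg.mainBound n d, key⟩
  refine Asymptotics.IsBigO.of_bound (SwitchReg.mainBound n d) ?_
  filter_upwards [Filter.eventually_ge_atTop 1] with N hN
  have := SwitchReg.maxCount_le hN (key N hN)
  rw [Real.norm_of_nonneg (by positivity), Real.norm_of_nonneg (by positivity)]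
  exact_mod_cast this
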